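/- Let $\lambda>0$ and $p_1,p_2\in(0,1]$. Item $m$ ($m=1,2,\dots$) has $N_m\sim\mathrm{Poisson}(\lambda)$ defects and, conditionally on $N_m$, two inspectors detect independent numbers $R_{m,1}\sim\mathrm{Binomial}(N_m,p_1)$ and $R_{m,2}\sim\mathrm{Binomial}(N_m,p_2)$ of them; the triples $(N_m,R_{m,1},R_{m,2})$ for different items $m$ are independent. For $M\ge 2$ put $$\bar r_i=\frac1M\sum_{m=1}^M R_{m,i}\quad(i=1,2),\qquad \hat S_{1,2}=\frac1{M-1}\sum_{m=1}^M (R_{m,1}-\bar r_1)(R_{m,2}-\bar r_2),$$ and define the moment estimators $$\hat p_1=\frac{\hat S_{1,2}}{\bar r_2},\qquad \hat p_2=\frac{\hat S_{1,2}}{\bar r_1},\qquad \hat\lambda=\frac{\bar r_1\bar r_2}{\hat S_{1,2}},$$ each estimator being given an arbitrary fixed real value $c$ (not depending on $M$) on the event that its denominator is zero. Then the three estimators are integrable for every $M\ge2$ and, as $M\to\infty$ with $\lambda,p_1,p_2,c$ fixed, $$E(\hat p_1)=p_1+O\!\left(\frac1{M^2}\right),\qquad E(\hat p_2)=p_2+O\!\left(\frac1{M^2}\right),$$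 $$E(\hat\lambda)=\lambda+\left((\lambda+1)\left(1+\frac1{p_1p_2}\right)-\frac1{p_1}-\frac1{p_2}\right)\frac1M+O\!\left(\frac1{M^2}\right).$$ -/

import Mathlib

open MeasureTheory ProbabilityTheory Filter Asymptotics
open scoped NNReal unitInterval

noncomputable section

namespace DefectInspection

/-- The two-inspector model. Item `m` contains `N m` defects; `R₁ m`, `R₂ m` are the numbers of
them detected by the first and the second inspector.
* different items are independent;
* `N m` is Poisson with mean `lam`;
* conditionally on `N m = n`, the counts `R₁ m` and `R₂ m` are independent, with distributions
  `Binomial (n, p₁)` and `Binomial (n, p₂)`. -/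
structure Model {Ω : Type*} [MeasurableSpace Ω] (P : Measure Ω) (lam : ℝ≥0) (p₁ p₂ : I)
    (N R₁ R₂ : ℕ → Ω → ℕ) : Prop where
  measurable_N : ∀ m, Measurable (N m)
  measurable_R₁ : ∀ m, Measurable (R₁ m)
  measurable_R₂ : ∀ m, Measurable (R₂ m)
  indep_items : iIndepFun (fun m ω => (N m ω, R₁ m ω, R₂ m ω)) P
  law_N : ∀ m, HasLaw (N m) (poissonMeasure lam) P
  cond_law_R₁ : ∀ m n, HasLaw (R₁ m) (binomial n p₁) (cond P {ω | N m ω = n})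
  cond_law_R₂ : ∀ m n, HasLaw (R₂ m) (binomial n p₂) (cond P {ω | N m ω = n})
  cond_indep : ∀ m n, IndepFun (R₁ m) (R₂ m) (cond P {ω | N m ω = n})

/-- The sample mean `(1 / M) ∑ r_m` of the first `M` terms of `r`. -/
def sampleMean (r : ℕ → ℕ) (M : ℕ) : ℝ :=
  1 / (M : ℝ) * ∑ m ∈ Finset.range M, (r m : ℝ)

/-- The unbiased sample covariance `(1 / (M - 1)) ∑ (r_m - r̄) (s_m - s̄)` of the first `M` pairs
`(r m, s m)`. -/
def sampleCov (r s : ℕ → ℕ) (M : ℕ) : ℝ :=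
  1 / ((M : ℝ) - 1) *
    ∑ m ∈ Finset.range M, ((r m : ℝ) - sampleMean r M) * ((s m : ℝ) - sampleMean s M)

open scoped Classical in
/-- The quotient `a / b` where it is defined, and the value `c` where `b = 0`. -/
def quotOr (c a b : ℝ) : ℝ := if b = 0 then c else a / b

/-- The moment estimator of the first detection rate from the data `r₁`, `r₂` on the first `M`
items; it takes the value `c` when the quotient defining it is undefined. -/
def pHat₁ (c : ℝ) (r₁ r₂ : ℕ → ℕ) (M : ℕ) : ℝ :=
  quotOr c (sampleCov r₁ r₂ M) (sampleMean r₂ M)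

/-- The moment estimator of the second detection rate; `c` as before. -/
def pHat₂ (c : ℝ) (r₁ r₂ : ℕ → ℕ) (M : ℕ) : ℝ :=
  quotOr c (sampleCov r₁ r₂ M) (sampleMean r₁ M)

/-- The moment estimator of the defect rate; `c` as before. -/
def lamHat (c : ℝ) (r₁ r₂ : ℕ → ℕ) (M : ℕ) : ℝ :=
  quotOr c (sampleMean r₁ M * sampleMean r₂ M) (sampleCov r₁ r₂ M)

end DefectInspection

end

/-! Up to the factor `M / (M - 1)`, each estimator is a quotient `q / D` of polynomials evaluated at
the averages of three centered variables: `R₁ - λp₁`, `R₂ - λp₂` and `(R₁ - λp₁)(R₂ - λp₂) - λp₁p₂`.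
The expectation is found by a second-order delta method (`expectation_quotient`), with particular
care for small or vanishing denominators.

With `e = 1 / D(0)` and `y = 1 - e * D`, the finite geometric series replaces `1 / D` by `e * (1 + y
+ y² + y³)`, with error `y⁴ / D`. Where `|y| ≤ 1/2`, `D` is bounded away from zero and the error is
of order `y⁴`. Elsewhere integrality helps: `M² * D` is an integer for the covariance and `M * D` is
one for the mean, so a nonzero `D` satisfies `1 / |D| ≤ M²`, while `y⁴ ≤ 16 * y⁸`. If `D = 0` then
`y = 1` and the estimator is bounded. Hence the error is dominated by polynomials in the averages
(`abs_sub_geometric_le`), which also yields integrability.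

A polynomial in the averages with no terms of degree below `k` has expectation `O(M ^ (-⌈k/2⌉))`
(`abs_integral_eval_le`), because isolated centered factors integrate to zero. So `y⁴` costs `M⁻²`,
`M² * y⁸` costs `M² * M⁻⁴`, and everything of degree at least three in the expansion is `O(M⁻²)`.
What survives is the constant term plus the quadratic part paired with the covariance matrix,
divided by `M`. That matrix comes from conditioning on `N` and the factorial moments of the Poisson
law. -/

namespace DefectInspection

/-! ### Functions with finite moments of all orders -/

section AllMoments

variable {Ω : Type*} [MeasurableSpace Ω]

/-- All absolute moments of `f` are finite. -/
def HasAllMoments (f : Ω → ℝ) (P : Measure Ω) : Prop := ∀ p : ℝ≥0, MemLp f p P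

namespace HasAllMoments

variable {P : Measure Ω} {f g : Ω → ℝ}

lemma integrable (hf : HasAllMoments f P) : Integrable f P :=
  memLp_one_iff_integrable.1 (by simpa using hf 1)

lemma const [IsFiniteMeasure P] (r : ℝ) : HasAllMoments (fun _ => r) P :=
  fun _ => memLp_const r

lemma add (hf : HasAllMoments f P) (hg : HasAllMoments g P) :
    HasAllMoments (fun ω => f ω + g ω) P :=
  fun p => (hf p).add (hg p)

lemma sub (hf : HasAllMoments f P) (hg : HasAllMoments g P) :
    HasAllMoments (fun ω => f ω - g ω) P :=
  fun p => (hf p).sub (hg p)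

/-- Hölder with exponents `2p, 2p` for the target `p`. A single fixed exponent would not be stable
under products; finiteness of all of them makes these functions an algebra, so polynomials need no
bookkeeping. -/
lemma mul (hf : HasAllMoments f P) (hg : HasAllMoments g P) :
    HasAllMoments (fun ω => f ω * g ω) P := by
  intro p
  have : ENNReal.HolderTriple ((2 * p : ℝ≥0) : ENNReal) ((2 * p : ℝ≥0) : ENNReal) p := by
    constructor
    rcases eq_or_ne p 0 with rfl | hp
    · simp
    · have h2 : (2 * p : ℝ≥0) ≠ 0 := by positivity
      rw [← ENNReal.coe_inv h2, ← ENNReal.coe_inv hp, ← ENNReal.coe_add]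
      congr 1
      field_simp
      norm_num
  exact (hg (2 * p)).mul' (hf (2 * p))

lemma const_mul (r : ℝ) (hf : HasAllMoments f P) : HasAllMoments (fun ω => r * f ω) P :=
  fun p => (hf p).const_mul r

lemma sum [IsFiniteMeasure P] {ι : Type*} (s : Finset ι) {F : ι → Ω → ℝ}
    (h : ∀ i ∈ s, HasAllMoments (F i) P) : HasAllMoments (fun ω => ∑ i ∈ s, F i ω) P :=
  fun p => memLp_finsetSum s fun i hi => h i hi p

lemma prod [IsFiniteMeasure P] {ι : Type*} (s : Finset ι) {F : ι → Ω → ℝ}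
    (h : ∀ i ∈ s, HasAllMoments (F i) P) : HasAllMoments (fun ω => ∏ i ∈ s, F i ω) P := by
  classical
  induction s using Finset.induction_on with
  | empty => simpa using const 1
  | insert i s hi ih =>
    simp only [Finset.prod_insert hi]
    exact (h i (by simp)).mul (ih fun j hj => h j (by simp [hj]))

lemma eval [IsFiniteMeasure P] {κ : Type*} {Z : κ → Ω → ℝ} (hZ : ∀ i, HasAllMoments (Z i) P)
    (q : MvPolynomial κ ℝ) : HasAllMoments (fun ω => MvPolynomial.eval (fun i => Z i ω) q) P := by
  induction q using MvPolynomial.induction_on with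
  | C r => simpa using const r
  | add p q hp hq => simpa using hp.add hq
  | mul_X p i hp => simpa using hp.mul (hZ i)

lemma mono (hf : HasAllMoments f P) (hg : AEStronglyMeasurable g P)
    (h : ∀ᵐ ω ∂P, ‖g ω‖ ≤ ‖f ω‖) : HasAllMoments g P :=
  fun p => (hf p).mono hg h

end HasAllMoments

end AllMoments

/-! ### Moments of sums of independent centered vectors -/

section CenteredSums

variable {Ω : Type*} [MeasurableSpace Ω] {P : Measure Ω} {κ : Type*}

/-- A sequence of independent centered random vectors `(X i m)_i` with finite moments of all
orders, whose mixed moments do not depend on `m`. -/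
structure CenteredSequence (P : Measure Ω) (X : κ → ℕ → Ω → ℝ) : Prop where
  measurable : ∀ i m, Measurable (X i m)
  indep : iIndepFun (fun m ω i => X i m ω) P
  moments : ∀ i m, HasAllMoments (X i m) P
  mean : ∀ i m, ∫ ω, X i m ω ∂P = 0
  stationary : ∀ (ι : Type) (s : Finset ι) (f : ι → κ) (m : ℕ),
    ∫ ω, ∏ j ∈ s, X (f j) m ω ∂P = ∫ ω, ∏ j ∈ s, X (f j) 0 ω ∂P

namespace CenteredSequence

variable {X : κ → ℕ → Ω → ℝ}

lemma indepFun_sum (hX : CenteredSequence P X) (n : ℕ) :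
    IndepFun (fun ω i => ∑ m ∈ Finset.range n, X i m ω) (fun ω i => X i n ω) P := by
  have hm : ∀ m, Measurable (fun ω i => X i m ω) := fun m =>
    measurable_pi_lambda _ fun i => hX.measurable i m
  have h := hX.indep.indepFun_finset (Finset.range n) {n} (by simp) hm
  have h1 : Measurable (fun (v : Finset.range n → κ → ℝ) (i : κ) =>
      ∑ m : Finset.range n, v m i) := by fun_prop
  have h2 : Measurable (fun (v : ({n} : Finset ℕ) → κ → ℝ) (i : κ) => v ⟨n, by simp⟩ i) := by
    fun_prop
  have h3 := h.comp h1 h2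
  have e : (fun ω i => ∑ m ∈ Finset.range n, X i m ω) =
      (fun (v : Finset.range n → κ → ℝ) (i : κ) => ∑ m : Finset.range n, v m i) ∘
        fun a (m : Finset.range n) i => X i m a := by
    funext ω i
    simpa using (Finset.sum_attach (Finset.range n) fun m => X i m ω).symm
  rw [e]
  exact h3

variable [IsProbabilityMeasure P]

lemma moments_sum (hX : CenteredSequence P X) (i : κ) (n : ℕ) :
    HasAllMoments (fun ω => ∑ m ∈ Finset.range n, X i m ω) P :=
  HasAllMoments.sum _ fun m _ => hX.moments i m

lemma integral_prod_mul_prod (hX : CenteredSequence P X) {ι : Type} (s t : Finset ι) (f : ι → κ)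
    (n : ℕ) :
    ∫ ω, (∏ j ∈ s, ∑ m ∈ Finset.range n, X (f j) m ω) * ∏ j ∈ t, X (f j) n ω ∂P =
      (∫ ω, ∏ j ∈ s, ∑ m ∈ Finset.range n, X (f j) m ω ∂P) *
        ∫ ω, ∏ j ∈ t, X (f j) 0 ω ∂P := by
  have h1 : Measurable (fun v : κ → ℝ => ∏ j ∈ s, v (f j)) := by fun_prop
  have h2 : Measurable (fun v : κ → ℝ => ∏ j ∈ t, v (f j)) := by fun_prop
  have h := ((hX.indepFun_sum n).comp h1 h2).integral_fun_mul_eq_mul_integral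
    (HasAllMoments.prod s fun j _ => hX.moments_sum (f j) n).integrable.aestronglyMeasurable
    (HasAllMoments.prod t fun j _ => hX.moments (f j) n).integrable.aestronglyMeasurable
  rw [← hX.stationary ι t f n]
  exact h

/-- Recursion in the number of summands: `t` collects the factors that take the old sum, its
complement those that take the new term, and independence splits the expectation. -/
lemma integral_prod_sum_succ (hX : CenteredSequence P X) {ι : Type}
    [DecidableEq ι] (s : Finset ι) (f : ι → κ) (n : ℕ) :
    ∫ ω, ∏ j ∈ s, ∑ m ∈ Finset.range (n + 1), X (f j) m ω ∂P =
      ∑ t ∈ s.powerset, (∫ ω, ∏ j ∈ t, ∑ m ∈ Finset.range n, X (f j) m ω ∂P) *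
        ∫ ω, ∏ j ∈ s \ t, X (f j) 0 ω ∂P := by
  simp only [Finset.sum_range_succ, Finset.prod_add]
  rw [integral_finsetSum]
  · exact Finset.sum_congr rfl fun t _ => hX.integral_prod_mul_prod t (s \ t) f n
  · intro t _
    exact ((HasAllMoments.prod t fun j _ => hX.moments_sum (f j) n).mul
      (HasAllMoments.prod (s \ t) fun j _ => hX.moments (f j) n)).integrable

/-- In the recursion for one more summand, `t = s` reproduces the previous moment, a complement of
size one contributes zero by centering, and any other proper `t` has at most `s.card - 2` elements.
The increment is therefore of order `n ^ (s.card / 2 - 1)`, and summing over `n` gains one power. -/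
theorem abs_integral_prod_sum_le (hX : CenteredSequence P X) {ι : Type} (s : Finset ι)
    (f : ι → κ) :
    ∃ C : ℝ, 0 ≤ C ∧ ∀ n : ℕ,
      |∫ ω, ∏ j ∈ s, ∑ m ∈ Finset.range n, X (f j) m ω ∂P| ≤ C * (n : ℝ) ^ (s.card / 2) := by
  classical
  induction s using Finset.strongInduction with
  | H s ih =>
  rcases s.eq_empty_or_nonempty with rfl | hs
  · exact ⟨1, by simp⟩
  -- The case `s.card < 2` is separated because the truncated exponent `s.card / 2 - 1` would then
  -- be `0`, not negative; all increments vanish there.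
  have hterm : ∀ t ∈ s.ssubsets, ∃ K : ℝ, 0 ≤ K ∧ ∀ n : ℕ,
      |(∫ ω, ∏ j ∈ t, ∑ m ∈ Finset.range n, X (f j) m ω ∂P) *
        ∫ ω, ∏ j ∈ s \ t, X (f j) 0 ω ∂P| ≤
        if s.card < 2 then 0 else K * ((n : ℝ) + 1) ^ (s.card / 2 - 1) := by
    intro t ht
    rw [Finset.mem_ssubsets] at ht
    have hsd : (s \ t).card = s.card - t.card := Finset.card_sdiff_of_subset ht.1
    have hlt : t.card < s.card := Finset.card_lt_card ht
    by_cases h1 : (s \ t).card = 1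
    · obtain ⟨j, hj⟩ := Finset.card_eq_one.1 h1
      refine ⟨0, le_rfl, fun n => ?_⟩
      simp [hj, hX.mean]
    · obtain ⟨C, hC0, hC⟩ := ih t ht
      refine ⟨C * |∫ ω, ∏ j ∈ s \ t, X (f j) 0 ω ∂P|, by positivity, fun n => ?_⟩
      rw [if_neg (by omega), abs_mul, mul_right_comm]
      gcongr
      refine (hC n).trans ?_
      gcongr ?_ * ?_
      calc (n : ℝ) ^ (t.card / 2) ≤ ((n : ℝ) + 1) ^ (t.card / 2) := by gcongr; linarith
        _ ≤ ((n : ℝ) + 1) ^ (s.card / 2 - 1) := by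
          apply pow_le_pow_right₀
          · linarith [(Nat.cast_nonneg n : (0 : ℝ) ≤ n)]
          · omega
  choose! K hK0 hK using hterm
  refine ⟨∑ t ∈ s.ssubsets, K t, Finset.sum_nonneg hK0, fun n => ?_⟩
  induction n with
  | zero =>
    have : ∫ ω, ∏ j ∈ s, ∑ m ∈ Finset.range 0, X (f j) m ω ∂P = 0 := by
      simp [hs.ne_empty]
    rw [this, abs_zero]
    have := Finset.sum_nonneg hK0
    positivity
  | succ n ihn =>
    rw [hX.integral_prod_sum_succ s f n, ← Finset.insert_erase (Finset.mem_powerset_self s),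
      Finset.sum_insert (by simp)]
    change |_ + ∑ t ∈ s.ssubsets, _| ≤ _
    simp only [sdiff_self, Finset.bot_eq_empty, Finset.prod_empty, integral_const, probReal_univ,
      smul_eq_mul, mul_one]
    refine (abs_add_le _ _).trans ((add_le_add ihn ((Finset.abs_sum_le_sum_abs _ _).trans
      (Finset.sum_le_sum fun t ht => hK t ht n))).trans ?_)
    by_cases h2 : s.card < 2
    · have : s.card / 2 = 0 := by omega
      simp [h2, this]
    · simp only [if_neg h2]
      obtain ⟨h, hh⟩ : ∃ h, s.card / 2 = h + 1 := ⟨s.card / 2 - 1, by omega⟩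
      rw [hh, Nat.add_sub_cancel, ← Finset.sum_mul, ← mul_add]
      have hS := Finset.sum_nonneg hK0
      gcongr
      push_cast
      rw [pow_succ, pow_succ, mul_add, mul_one]
      gcongr
      linarith

end CenteredSequence

end CenteredSums

/-! ### Averages and the delta method -/

section Averages

variable {Ω : Type*} [MeasurableSpace Ω] {P : Measure Ω} {κ : Type}

/-- The vector of averages of the first `n` terms. -/
noncomputable def average (X : κ → ℕ → Ω → ℝ) (n : ℕ) (ω : Ω) (i : κ) : ℝ :=
  1 / (n : ℝ) * ∑ m ∈ Finset.range n, X i m ω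

namespace CenteredSequence

variable {X : κ → ℕ → Ω → ℝ} [IsProbabilityMeasure P]

lemma moments_average (hX : CenteredSequence P X) (n : ℕ) (i : κ) :
    HasAllMoments (fun ω => average X n ω i) P :=
  (hX.moments_sum i n).const_mul _

lemma moments_eval_average (hX : CenteredSequence P X) (n : ℕ) (q : MvPolynomial κ ℝ) :
    HasAllMoments (fun ω => MvPolynomial.eval (average X n ω) q) P :=
  HasAllMoments.eval (Z := fun i ω => average X n ω i) (hX.moments_average n) q

lemma abs_integral_prod_average_le (hX : CenteredSequence P X) {ι : Type} (s : Finset ι)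
    (f : ι → κ) {k : ℕ} (hk : k ≤ s.card) :
    ∃ C : ℝ, 0 ≤ C ∧ ∀ n : ℕ, 1 ≤ n →
      |∫ ω, ∏ j ∈ s, average X n ω (f j) ∂P| ≤ C / (n : ℝ) ^ ((k + 1) / 2) := by
  obtain ⟨C, hC0, hC⟩ := hX.abs_integral_prod_sum_le s f
  refine ⟨C, hC0, fun n hn => ?_⟩
  have hn' : (1 : ℝ) ≤ n := by exact_mod_cast hn
  simp only [average, Finset.prod_mul_distrib, Finset.prod_const, integral_const_mul]
  rw [abs_mul, abs_of_nonneg (by positivity : (0 : ℝ) ≤ (1 / (n : ℝ)) ^ s.card)]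
  calc (1 / (n : ℝ)) ^ s.card * |∫ ω, ∏ j ∈ s, ∑ m ∈ Finset.range n, X (f j) m ω ∂P|
      ≤ (1 / (n : ℝ)) ^ s.card * (C * (n : ℝ) ^ (s.card / 2)) := by gcongr; exact hC n
    _ ≤ C / (n : ℝ) ^ ((k + 1) / 2) := by
      rw [one_div, inv_pow, inv_mul_eq_div, div_le_div_iff₀ (by positivity) (by positivity),
        mul_assoc, ← pow_add]
      gcongr
      omega

/-- The power of the ideal of variables encodes vanishing order at the origin, and `(k + 1) / 2` is
`⌈k/2⌉`: a product of `d` averages contributes `n ^ (d / 2 - d)`, and `d ≥ k`. -/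
theorem abs_integral_eval_le (hX : CenteredSequence P X) {q : MvPolynomial κ ℝ} {k : ℕ}
    (hq : q ∈ MvPolynomial.idealOfVars κ ℝ ^ k) :
    ∃ C : ℝ, 0 ≤ C ∧ ∀ n : ℕ, 1 ≤ n →
      |∫ ω, MvPolynomial.eval (average X n ω) q ∂P| ≤ C / (n : ℝ) ^ ((k + 1) / 2) := by
  classical
  rw [MvPolynomial.mem_pow_idealOfVars_iff] at hq
  -- Each variable is repeated according to its exponent, turning a monomial into a product over an
  -- index set of cardinality its degree.
  let s : (d : κ →₀ ℕ) → Finset ((i : κ) × Fin (d i)) := fun d =>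
    d.support.sigma fun _ => Finset.univ
  have hprod : ∀ (d : κ →₀ ℕ) n ω, ∏ i ∈ d.support, average X n ω i ^ d i =
      ∏ j ∈ s d, average X n ω j.1 := by
    intro d n ω
    simp [s, Finset.prod_sigma]
  have hbd : ∀ d ∈ q.support, ∃ C : ℝ, 0 ≤ C ∧ ∀ n : ℕ, 1 ≤ n →
      |∫ ω, ∏ j ∈ s d, average X n ω j.1 ∂P| ≤ C / (n : ℝ) ^ ((k + 1) / 2) := by
    intro d hd
    apply hX.abs_integral_prod_average_le
    simp only [s, Finset.card_sigma, Finset.card_univ, Fintype.card_fin]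
    exact hq d hd
  choose! C hC0 hC using hbd
  refine ⟨∑ d ∈ q.support, |q.coeff d| * C d,
    Finset.sum_nonneg fun d hd => mul_nonneg (abs_nonneg _) (hC0 d hd), fun n hn => ?_⟩
  simp only [MvPolynomial.eval_eq, hprod]
  rw [integral_finsetSum]
  · simp only [integral_const_mul]
    refine (Finset.abs_sum_le_sum_abs _ _).trans ?_
    rw [Finset.sum_div]
    refine Finset.sum_le_sum fun d hd => ?_
    rw [abs_mul, mul_div_assoc]
    gcongr
    exact hC d hd n hn
  · intro d _
    exact ((HasAllMoments.prod _ fun j _ => hX.moments_average n j.1).const_mul _).integrable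

omit [IsProbabilityMeasure P] in
lemma integral_average (hX : CenteredSequence P X) (n : ℕ) (i : κ) :
    ∫ ω, average X n ω i ∂P = 0 := by
  simp only [average, integral_const_mul]
  rw [integral_finsetSum _ fun m _ => (hX.moments i m).integrable]
  simp [hX.mean]

lemma integral_sum_mul_sum (hX : CenteredSequence P X) (n : ℕ) (i j : κ) :
    ∫ ω, (∑ m ∈ Finset.range n, X i m ω) * ∑ m ∈ Finset.range n, X j m ω ∂P =
      n * ∫ ω, X i 0 ω * X j 0 ω ∂P := by
  induction n with
  | zero => simp
  | succ n ih =>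
    have h := hX.integral_prod_sum_succ (Finset.univ : Finset (Fin 2)) ![i, j] n
    have e : (Finset.univ : Finset (Fin 2)).powerset = {∅, {0}, {1}, {0, 1}} := by decide
    have e1 : (Finset.univ : Finset (Fin 2)) \ {0} = {1} := by decide
    have e2 : (Finset.univ : Finset (Fin 2)) \ {1} = {0} := by decide
    have e3 : (Finset.univ : Finset (Fin 2)) \ {0, 1} = ∅ := by decide
    rw [e, Finset.sum_insert (by decide), Finset.sum_insert (by decide),
      Finset.sum_insert (by decide), Finset.sum_singleton, e1, e2, e3] at h
    simp only [Fin.prod_univ_two, Matrix.cons_val_zero, Matrix.cons_val_one, Finset.prod_empty,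
      Finset.prod_singleton, hX.mean, Finset.sdiff_empty, integral_const, probReal_univ,
      smul_eq_mul, mul_one, one_mul, mul_zero, zero_add,
      Finset.prod_pair (show (0 : Fin 2) ≠ 1 by decide), ih] at h
    rw [h]
    push_cast
    ring

lemma integral_average_mul_average (hX : CenteredSequence P X) {n : ℕ} (hn : 1 ≤ n) (i j : κ) :
    ∫ ω, average X n ω i * average X n ω j ∂P = (∫ ω, X i 0 ω * X j 0 ω ∂P) / n := by
  have hn' : (n : ℝ) ≠ 0 := by positivity
  have : ∀ ω, average X n ω i * average X n ω j = (1 / (n : ℝ)) ^ 2 *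
      ((∑ m ∈ Finset.range n, X i m ω) * ∑ m ∈ Finset.range n, X j m ω) := by
    intro ω; simp only [average]; ring
  simp only [this, integral_const_mul, hX.integral_sum_mul_sum]
  field_simp

end CenteredSequence

/-- The polynomial of degree at most two with the given coefficients. -/
noncomputable def quadraticPolynomial [Fintype κ] (c₀ : ℝ) (l : κ → ℝ) (Q : κ → κ → ℝ) :
    MvPolynomial κ ℝ :=
  MvPolynomial.C c₀ + ∑ i, MvPolynomial.C (l i) * MvPolynomial.X i +
    ∑ i, ∑ j, MvPolynomial.C (Q i j) * (MvPolynomial.X i * MvPolynomial.X j)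

namespace CenteredSequence

variable {X : κ → ℕ → Ω → ℝ} [IsProbabilityMeasure P] [Fintype κ]

lemma integral_eval_quadraticPolynomial (hX : CenteredSequence P X) {n : ℕ} (hn : 1 ≤ n) (c₀ : ℝ)
    (l : κ → ℝ) (Q : κ → κ → ℝ) :
    ∫ ω, MvPolynomial.eval (average X n ω) (quadraticPolynomial c₀ l Q) ∂P =
      c₀ + (∑ i, ∑ j, Q i j * ∫ ω, X i 0 ω * X j 0 ω ∂P) / n := by
  have h1 : HasAllMoments (fun ω => ∑ i, l i * average X n ω i) P :=
    HasAllMoments.sum _ fun i _ => (hX.moments_average n i).const_mul _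
  have h2 : ∀ i j, HasAllMoments (fun ω => Q i j * (average X n ω i * average X n ω j)) P :=
    fun i j => ((hX.moments_average n i).mul (hX.moments_average n j)).const_mul _
  have h3 : ∀ i, HasAllMoments (fun ω => ∑ j, Q i j * (average X n ω i * average X n ω j)) P :=
    fun i => HasAllMoments.sum _ fun j _ => h2 i j
  simp only [quadraticPolynomial, map_add, map_sum, map_mul, MvPolynomial.eval_C,
    MvPolynomial.eval_X]
  rw [integral_add (((HasAllMoments.const c₀).add h1).integrable)
      (HasAllMoments.sum _ fun i _ => h3 i).integrable,
    integral_add (integrable_const _) h1.integrable,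
    integral_finsetSum _ fun i _ => ((hX.moments_average n i).const_mul _).integrable,
    integral_finsetSum _ fun i _ => (h3 i).integrable]
  simp only [integral_finsetSum _ fun j _ => (h2 _ j).integrable, integral_const_mul,
    hX.integral_average, hX.integral_average_mul_average hn, Finset.sum_div, mul_div_assoc]
  simp

end CenteredSequence

/-- For `d ≠ 0` the error is exactly `q * y ^ 4 / d` with `y = 1 - e * d`. If `|y| ≤ 1/2` then `|e *
d| ≥ 1/2`; otherwise `1 ≤ 16 * y ^ 4` and `1 / |d| ≤ r`. For `d = 0`, `y = 1`. Using `1 + q ^ 2` in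
place of `|q|` keeps the majorant polynomial in `q` and `d`. -/
lemma abs_sub_geometric_le {q d e K F r : ℝ} (he : e ≠ 0) (hK : 0 ≤ K) (hr : 0 ≤ r)
    (h0 : d = 0 → |F| ≤ K) (h1 : d ≠ 0 → F = q / d ∧ 1 ≤ r * |d|) :
    |F - q * e * (1 + (1 - e * d) + (1 - e * d) ^ 2 + (1 - e * d) ^ 3)| ≤
      (K + 4 * |e| * (1 + q ^ 2)) * (1 - e * d) ^ 4 +
        r * (16 * (1 + q ^ 2) * (1 - e * d) ^ 8) := by
  have hq : |q| ≤ 1 + q ^ 2 := by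
    rw [← sq_abs q]; nlinarith [sq_nonneg (|q| - 1), abs_nonneg q]
  rcases eq_or_ne d 0 with hd | hd
  · have hF := h0 hd
    simp only [hd, mul_zero, sub_zero, one_pow, mul_one]
    calc |F - q * e * (1 + 1 + 1 + 1)| ≤ |F| + |q * e * (1 + 1 + 1 + 1)| := abs_sub _ _
      _ = |F| + 4 * |e| * |q| := by rw [abs_mul, abs_mul]; norm_num; ring
      _ ≤ K + 4 * |e| * (1 + q ^ 2) := by gcongr
      _ ≤ _ := le_add_of_nonneg_right (by positivity)
  · obtain ⟨rfl, hrd⟩ := h1 hd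
    set y := 1 - e * d with hy
    have hed : e * d = 1 - y := by rw [hy]; ring
    have hd' : 0 < |d| := abs_pos.2 hd
    have key : q / d - q * e * (1 + y + y ^ 2 + y ^ 3) = q * y ^ 4 / d := by
      field_simp
      linear_combination (-q * (1 + y + y ^ 2 + y ^ 3)) * hed
    have y4 : |y ^ 4| = y ^ 4 := abs_of_nonneg (by positivity)
    rw [key, abs_div, abs_mul, y4, div_le_iff₀ hd']
    have a1 : 0 ≤ K * y ^ 4 * |d| := by positivity
    by_cases hc : |y| ≤ 1 / 2
    · have h2 : 1 ≤ 4 * (|e| * |d|) := by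
        rw [← abs_mul, hed]
        have := abs_sub_abs_le_abs_sub 1 y
        rw [abs_one] at this
        linarith
      have h3 : |q| * y ^ 4 ≤ (1 + q ^ 2) * y ^ 4 := by gcongr
      have h4 : (1 + q ^ 2) * y ^ 4 * 1 ≤ (1 + q ^ 2) * y ^ 4 * (4 * (|e| * |d|)) := by gcongr
      have a2 : 0 ≤ r * (16 * (1 + q ^ 2) * y ^ 8) * |d| := by positivity
      linarith
    · push Not at hc
      have h2 : 1 ≤ 16 * y ^ 4 := by
        have : (1 / 2) ^ 4 ≤ |y| ^ 4 := by gcongr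
        rw [pow_abs, y4] at this
        linarith
      have h3 : |q| * y ^ 4 ≤ (1 + q ^ 2) * y ^ 4 := by gcongr
      have h4 : (1 + q ^ 2) * y ^ 4 * 1 ≤ (1 + q ^ 2) * y ^ 4 * (16 * y ^ 4) := by gcongr
      have h5 : (1 + q ^ 2) * y ^ 4 * (16 * y ^ 4) * 1 ≤
          (1 + q ^ 2) * y ^ 4 * (16 * y ^ 4) * (r * |d|) := by gcongr
      have a2 : 0 ≤ 4 * |e| * (1 + q ^ 2) * y ^ 4 * |d| := by positivity
      linarith

namespace CenteredSequence

variable {X : κ → ℕ → Ω → ℝ} [IsProbabilityMeasure P] [Fintype κ]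

/-- The second order delta method for a quotient of polynomials in the averages. -/
theorem expectation_quotient (hX : CenteredSequence P X) {q D : MvPolynomial κ ℝ} {e K c₀ : ℝ}
    {l : κ → ℝ} {Q : κ → κ → ℝ} (he : e ≠ 0) (hK : 0 ≤ K)
    (hY : 1 - MvPolynomial.C e * D ∈ MvPolynomial.idealOfVars κ ℝ)
    (hL : q * MvPolynomial.C e * (1 + (1 - MvPolynomial.C e * D) + (1 - MvPolynomial.C e * D) ^ 2 +
      (1 - MvPolynomial.C e * D) ^ 3) - quadraticPolynomial c₀ l Q ∈
        MvPolynomial.idealOfVars κ ℝ ^ 3)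
    {F : ℕ → Ω → ℝ} (hF : ∀ n, AEStronglyMeasurable (F n) P)
    (h0 : ∀ n, 2 ≤ n → ∀ ω, MvPolynomial.eval (average X n ω) D = 0 → |F n ω| ≤ K)
    (h1 : ∀ n, 2 ≤ n → ∀ ω, MvPolynomial.eval (average X n ω) D ≠ 0 →
      F n ω = MvPolynomial.eval (average X n ω) q / MvPolynomial.eval (average X n ω) D ∧
        1 ≤ (n : ℝ) ^ 2 * |MvPolynomial.eval (average X n ω) D|) :
    (∀ n, 2 ≤ n → Integrable (F n) P) ∧ ∃ C : ℝ, ∀ n : ℕ, 2 ≤ n →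
      |∫ ω, F n ω ∂P - (c₀ + (∑ i, ∑ j, Q i j * ∫ ω, X i 0 ω * X j 0 ω ∂P) / n)| ≤
        C / (n : ℝ) ^ 2 := by
  set Y := 1 - MvPolynomial.C e * D with hYdef
  set T := q * MvPolynomial.C e * (1 + Y + Y ^ 2 + Y ^ 3) with hT
  -- The two parts of the majorant: order `4` gives `n⁻²`, and order `8` gives `n⁻⁴`, which absorbs
  -- the factor `n ^ 2` from the crude bound on `1 / |D|`.
  let B₁ : MvPolynomial κ ℝ :=
    (MvPolynomial.C K + MvPolynomial.C (4 * |e|) * (1 + q ^ 2)) * Y ^ 4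
  let B₂ : MvPolynomial κ ℝ := (MvPolynomial.C 16 * (1 + q ^ 2)) * Y ^ 8
  have hB₁ : B₁ ∈ MvPolynomial.idealOfVars κ ℝ ^ 4 :=
    Ideal.mul_mem_left _ _ (Ideal.pow_mem_pow hY 4)
  have hB₂ : B₂ ∈ MvPolynomial.idealOfVars κ ℝ ^ 8 :=
    Ideal.mul_mem_left _ _ (Ideal.pow_mem_pow hY 8)
  have hmom := hX.moments_eval_average
  have hbound : ∀ n, 2 ≤ n → ∀ ω, |F n ω - MvPolynomial.eval (average X n ω) T| ≤
      MvPolynomial.eval (average X n ω) B₁ +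
        (n : ℝ) ^ 2 * MvPolynomial.eval (average X n ω) B₂ := by
    intro n hn ω
    have := abs_sub_geometric_le he hK (by positivity : (0 : ℝ) ≤ (n : ℝ) ^ 2) (h0 n hn ω)
      (h1 n hn ω)
    simpa [hT, hYdef, B₁, B₂] using this
  have hmaj : ∀ n : ℕ, Integrable (fun ω => MvPolynomial.eval (average X n ω) B₁ +
      (n : ℝ) ^ 2 * MvPolynomial.eval (average X n ω) B₂) P := fun n =>
    ((hmom n B₁).add ((hmom n B₂).const_mul _)).integrable
  have hdiff : ∀ n, 2 ≤ n →
      Integrable (fun ω => F n ω - MvPolynomial.eval (average X n ω) T) P := fun n hn =>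
    (hmaj n).mono' ((hF n).sub (hmom n T).integrable.aestronglyMeasurable)
      (.of_forall fun ω => hbound n hn ω)
  have hint : ∀ n, 2 ≤ n → Integrable (F n) P := by
    intro n hn
    have := (hdiff n hn).add (hmom n T).integrable
    refine this.congr (.of_forall fun ω => ?_)
    simp
  refine ⟨hint, ?_⟩
  obtain ⟨C₁, -, hC₁⟩ := hX.abs_integral_eval_le hB₁
  obtain ⟨C₂, -, hC₂⟩ := hX.abs_integral_eval_le hB₂
  obtain ⟨C₃, -, hC₃⟩ := hX.abs_integral_eval_le hL
  refine ⟨C₁ + C₂ + C₃, fun n hn => ?_⟩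
  have hn1 : 1 ≤ n := by omega
  have hn0 : (n : ℝ) ≠ 0 := by positivity
  have e1 : ∫ ω, F n ω ∂P - (c₀ + (∑ i, ∑ j, Q i j * ∫ ω, X i 0 ω * X j 0 ω ∂P) / n) =
      ∫ ω, F n ω - MvPolynomial.eval (average X n ω) T ∂P +
      ∫ ω, MvPolynomial.eval (average X n ω) (T - quadraticPolynomial c₀ l Q) ∂P := by
    simp only [map_sub]
    rw [integral_sub (hint n hn) (hmom n T).integrable, integral_sub (hmom n T).integrable
      (hmom n _).integrable, hX.integral_eval_quadraticPolynomial hn1]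
    ring
  have e2 : |∫ ω, F n ω - MvPolynomial.eval (average X n ω) T ∂P| ≤ (C₁ + C₂) / (n : ℝ) ^ 2 := by
    calc |∫ ω, F n ω - MvPolynomial.eval (average X n ω) T ∂P|
        ≤ ∫ ω, (MvPolynomial.eval (average X n ω) B₁ +
          (n : ℝ) ^ 2 * MvPolynomial.eval (average X n ω) B₂) ∂P :=
          norm_integral_le_of_norm_le (f := fun ω => F n ω - MvPolynomial.eval (average X n ω) T)
            (hmaj n) (.of_forall fun ω => hbound n hn ω)
      _ = ∫ ω, MvPolynomial.eval (average X n ω) B₁ ∂P +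
          (n : ℝ) ^ 2 * ∫ ω, MvPolynomial.eval (average X n ω) B₂ ∂P := by
        rw [integral_add (hmom n B₁).integrable ((hmom n B₂).const_mul _).integrable,
          integral_const_mul]
      _ ≤ C₁ / (n : ℝ) ^ 2 + (n : ℝ) ^ 2 * (C₂ / (n : ℝ) ^ 4) := by
        gcongr
        · exact (le_abs_self _).trans (hC₁ n hn1)
        · exact (le_abs_self _).trans (hC₂ n hn1)
      _ = (C₁ + C₂) / (n : ℝ) ^ 2 := by field_simp
  rw [e1, add_div]
  exact (abs_add_le _ _).trans (add_le_add e2 (hC₃ n hn1))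

end CenteredSequence

end Averages

/-! ### Moments of the Poisson law -/

section Poisson

/-- The moment generating function is finite at every real argument, so `0` is interior to its
domain. -/
lemma hasAllMoments_poissonMeasure (r : ℝ≥0) :
    HasAllMoments (fun n : ℕ => (n : ℝ)) (poissonMeasure r) := by
  apply memLp_of_mem_interior_integrableExpSet
  have : integrableExpSet (fun n : ℕ => (n : ℝ)) (poissonMeasure r) = Set.univ := by
    refine Set.eq_univ_of_forall fun t => ?_
    change Integrable _ _
    rw [integrable_poissonMeasure_iff]
    refine ((Real.summable_pow_div_factorial (r * Real.exp t)).mul_left (Real.exp (-r))).congr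
      fun n => ?_
    rw [Real.norm_eq_abs, Real.abs_exp, mul_pow, ← Real.exp_nat_mul, mul_comm (n : ℝ) t]
    ring
  simp [this]

lemma integral_descFactorial_poissonMeasure (r : ℝ≥0) (k : ℕ) :
    ∫ n, (n.descFactorial k : ℝ) ∂poissonMeasure r = (r : ℝ) ^ k := by
  rw [integral_poissonMeasure]
  have h := (hasSum_one_poissonMeasure r).mul_left ((r : ℝ) ^ k)
  have h2 : HasSum (fun n : ℕ => (Real.exp (-r) * (r : ℝ) ^ n / (n.factorial : ℝ)) •
      (n.descFactorial k : ℝ)) ((r : ℝ) ^ k) := by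
    rw [← hasSum_nat_add_iff' k, Finset.sum_eq_zero, sub_zero]
    · rw [mul_one] at h
      refine h.congr_fun fun n => ?_
      have h3 := Nat.factorial_mul_descFactorial (Nat.le_add_left k n)
      rw [Nat.add_sub_cancel] at h3
      have h4 : ((n + k).factorial : ℝ) = n.factorial * (n + k).descFactorial k := by
        exact_mod_cast h3.symm
      have h5 : ((n + k).descFactorial k : ℝ) ≠ 0 := by
        have := Nat.pow_sub_le_descFactorial (n + k) k
        have : 0 < (n + k).descFactorial k := Nat.pos_of_ne_zero fun h0 => by
          rw [Nat.descFactorial_eq_zero_iff_lt] at h0; omega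
        positivity
      have h6 : (n.factorial : ℝ) ≠ 0 := by positivity
      rw [h4, smul_eq_mul, pow_add]
      field_simp
    · intro n hn
      rw [Nat.descFactorial_eq_zero_iff_lt.2 (Finset.mem_range.1 hn)]
      simp
  exact h2.tsum_eq

lemma cast_descFactorial_succ (n k : ℕ) :
    (n.descFactorial (k + 1) : ℝ) = n.descFactorial k * (n - k) := by
  rw [Nat.descFactorial_succ, mul_comm]
  rcases le_or_gt k n with hk | hk
  · push_cast [hk]
    ring
  · simp [Nat.descFactorial_eq_zero_iff_lt.2 hk]

/-- Expectation of a polynomial of degree at most four, given in the basis of falling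
factorials. -/
lemma integral_quartic_poissonMeasure (r : ℝ≥0) (c₀ c₁ c₂ c₃ c₄ : ℝ) :
    ∫ n : ℕ, (c₀ + c₁ * n + c₂ * (n * (n - 1)) + c₃ * (n * (n - 1) * (n - 2)) +
      c₄ * (n * (n - 1) * (n - 2) * (n - 3)) : ℝ) ∂poissonMeasure r =
      c₀ + c₁ * r + c₂ * r ^ 2 + c₃ * r ^ 3 + c₄ * r ^ 4 := by
  have h := hasAllMoments_poissonMeasure r
  have hs : ∀ c : ℝ, HasAllMoments (fun n : ℕ => (n : ℝ) - c) (poissonMeasure r) := fun c =>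
    h.sub (HasAllMoments.const c)
  have i1 := h.const_mul c₁
  have i2 := (h.mul (hs 1)).const_mul c₂
  have i3 := ((h.mul (hs 1)).mul (hs 2)).const_mul c₃
  have i4 := (((h.mul (hs 1)).mul (hs 2)).mul (hs 3)).const_mul c₄
  have i0 : HasAllMoments (fun _ => c₀) (poissonMeasure r) := HasAllMoments.const c₀
  rw [integral_add (((i0.add i1).add i2).add i3).integrable i4.integrable,
    integral_add ((i0.add i1).add i2).integrable i3.integrable,
    integral_add (i0.add i1).integrable i2.integrable,
    integral_add i0.integrable i1.integrable]
  have e2 : ∀ n : ℕ, (n : ℝ) * (n - 1) = n.descFactorial 2 := fun n => by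
    rw [cast_descFactorial_succ n 1]
    simp
  have e3 : ∀ n : ℕ, (n.descFactorial 2 : ℝ) * (n - 2) = n.descFactorial 3 := fun n => by
    rw [cast_descFactorial_succ n 2, Nat.cast_ofNat]
  have e4 : ∀ n : ℕ, (n.descFactorial 3 : ℝ) * (n - 3) = n.descFactorial 4 := fun n => by
    rw [cast_descFactorial_succ n 3, Nat.cast_ofNat]
  have e1 := integral_descFactorial_poissonMeasure r 1
  simp only [Nat.descFactorial_one, pow_one] at e1
  simp only [integral_const_mul, e2, e3, e4, integral_descFactorial_poissonMeasure, e1]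
  simp

end Poisson

/-! ### First two moments of the binomial law, from Bernstein polynomial identities -/

section Binomial

lemma integral_id_binomial (n : ℕ) (p : I) : ∫ k, (k : ℝ) ∂binomial n p = n * p := by
  rw [integral_binomial]
  have h := congrArg (Polynomial.eval (p : ℝ)) (bernsteinPolynomial.sum_smul ℝ n)
  simp only [Polynomial.eval_finsetSum, Polynomial.eval_X, nsmul_eq_mul,
    bernsteinPolynomial, Polynomial.eval_mul, Polynomial.eval_pow, Polynomial.eval_sub,
    Polynomial.eval_one, Polynomial.eval_natCast] at h
  rw [← h, Nat.range_succ_eq_Iic]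
  exact Finset.sum_congr rfl fun k _ => by rw [smul_eq_mul]; ring

lemma integral_sq_binomial (n : ℕ) (p : I) :
    ∫ k, (k : ℝ) ^ 2 ∂binomial n p = n * p + n * (n - 1) * p ^ 2 := by
  have h1 := integral_id_binomial n p
  rw [integral_binomial] at h1 ⊢
  have h := congrArg (Polynomial.eval (p : ℝ)) (bernsteinPolynomial.sum_mul_smul ℝ n)
  simp only [Polynomial.eval_finsetSum, Polynomial.eval_X, nsmul_eq_mul,
    bernsteinPolynomial, Polynomial.eval_mul, Polynomial.eval_pow, Polynomial.eval_sub,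
    Polynomial.eval_one, Polynomial.eval_natCast, Nat.range_succ_eq_Iic] at h
  have hc : ∀ k : ℕ, ((k * (k - 1) : ℕ) : ℝ) = k * (k - 1) := by
    intro k; cases k <;> simp
  simp only [hc] at h
  rw [← h1, ← h, ← Finset.sum_add_distrib]
  exact Finset.sum_congr rfl fun k _ => by simp only [smul_eq_mul]; ring

/-- The first three moments of the binomial distribution. -/
def binomialMoment (p x : ℝ) : Fin 3 → ℝ := ![1, x * p, x * p + x * (x - 1) * p ^ 2]

lemma integral_pow_binomial (n : ℕ) (p : I) (i : Fin 3) :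
    ∫ k, (k : ℝ) ^ (i : ℕ) ∂binomial n p = binomialMoment p n i := by
  fin_cases i
  · simp [binomialMoment]
  · simpa [binomialMoment] using integral_id_binomial n p
  · simpa [binomialMoment] using integral_sq_binomial n p

end Binomial

/-! ### Conditioning on the number of defects -/

namespace Model

variable {Ω : Type*} [MeasurableSpace Ω] {P : Measure Ω} [IsProbabilityMeasure P]
  {lam : ℝ≥0} {p₁ p₂ : I} {N R₁ R₂ : ℕ → Ω → ℕ}

omit [IsProbabilityMeasure P] in
lemma measurableSet_fiber (h : Model P lam p₁ p₂ N R₁ R₂) (m n : ℕ) :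
    MeasurableSet {ω | N m ω = n} :=
  h.measurable_N m (measurableSet_singleton n)

omit [IsProbabilityMeasure P] in
lemma hasAllMoments_N (h : Model P lam p₁ p₂ N R₁ R₂) (m : ℕ) :
    HasAllMoments (fun ω => (N m ω : ℝ)) P := by
  intro p
  have := hasAllMoments_poissonMeasure lam p
  rw [← (h.law_N m).map_eq] at this
  exact this.comp_of_map (h.law_N m).aemeasurable

omit [IsProbabilityMeasure P] in
-- Dominating the detected counts by `N` transfers to them the finiteness of all Poisson moments.
lemma ae_le_of_cond_law [IsFiniteMeasure P] {N R : Ω → ℕ} (hN : Measurable N) {p : I}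
    (hR : ∀ n, HasLaw R (binomial n p) (cond P {ω | N ω = n})) :
    ∀ᵐ ω ∂P, R ω ≤ N ω := by
  have key : ∀ n, ∀ᵐ ω ∂P, N ω = n → R ω ≤ n := by
    intro n
    have h1 := ae_le_of_hasLaw_binomial (hR n)
    rw [ProbabilityTheory.cond, Measure.ae_ennreal_smul_measure_iff (by simp),
      ae_restrict_iff' (show MeasurableSet {ω | N ω = n} from hN (measurableSet_singleton n))] at h1
    exact h1
  filter_upwards [ae_all_iff.2 key] with ω hω using hω _ rfl

omit [IsProbabilityMeasure P] in
lemma hasAllMoments_of_le (h : Model P lam p₁ p₂ N R₁ R₂) {m : ℕ} {R : Ω → ℕ} (hR : Measurable R)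
    (hle : ∀ᵐ ω ∂P, R ω ≤ N m ω) : HasAllMoments (fun ω => (R ω : ℝ)) P := by
  refine (h.hasAllMoments_N m).mono ?_ ?_
  · exact ((measurable_from_top (f := fun k : ℕ => (k : ℝ))).comp hR).aestronglyMeasurable
  · filter_upwards [hle] with ω hω
    simpa using hω

lemma hasAllMoments_R₁ (h : Model P lam p₁ p₂ N R₁ R₂) (m : ℕ) :
    HasAllMoments (fun ω => (R₁ m ω : ℝ)) P :=
  h.hasAllMoments_of_le (h.measurable_R₁ m) (ae_le_of_cond_law (h.measurable_N m) (h.cond_law_R₁ m))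

lemma hasAllMoments_R₂ (h : Model P lam p₁ p₂ N R₁ R₂) (m : ℕ) :
    HasAllMoments (fun ω => (R₂ m ω : ℝ)) P :=
  h.hasAllMoments_of_le (h.measurable_R₂ m) (ae_le_of_cond_law (h.measurable_N m) (h.cond_law_R₂ m))

lemma integral_mul (h : Model P lam p₁ p₂ N R₁ R₂) (m : ℕ) {f g : ℕ → ℝ}
    (hfg : Integrable (fun ω => f (R₁ m ω) * g (R₂ m ω)) P) :
    ∫ ω, f (R₁ m ω) * g (R₂ m ω) ∂P =
      ∫ n, (∫ k, f k ∂binomial n p₁) * ∫ k, g k ∂binomial n p₂ ∂poissonMeasure lam := by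
  have hU : (⋃ n, {ω | N m ω = n}) = Set.univ := by ext; simp
  have hS : HasSum (fun n => ∫ ω in {ω | N m ω = n}, f (R₁ m ω) * g (R₂ m ω) ∂P)
      (∫ ω, f (R₁ m ω) * g (R₂ m ω) ∂P) := by
    have := hasSum_integral_iUnion (μ := P) (s := fun n => {ω | N m ω = n})
      (f := fun ω => f (R₁ m ω) * g (R₂ m ω)) (h.measurableSet_fiber m)
      (fun i j hij => Set.disjoint_left.2 fun ω (hi : _ = _) (hj : _ = _) => hij (hi ▸ hj))
      (by rw [hU]; exact hfg.integrableOn)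
    rwa [hU, setIntegral_univ] at this
  rw [← hS.tsum_eq, integral_poissonMeasure]
  refine tsum_congr fun n => ?_
  have hP : P.real {ω | N m ω = n} = Real.exp (-lam) * (lam : ℝ) ^ n / (n.factorial : ℝ) := by
    rw [← poissonMeasure_real_singleton]
    exact (h.law_N m).measureReal_eq (p := (· = n)) (measurableSet_singleton n)
  -- Conditioning on a null event would give the zero measure, which cannot carry a binomial law; so
  -- every fiber of `N` has positive probability.
  have hp := (h.cond_law_R₁ m n).isProbabilityMeasure
  have h0 : P {ω | N m ω = n} ≠ 0 := fun h0 =>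
    hp.ne_zero _ (cond_eq_zero_of_meas_eq_zero h0)
  have hc : ∫ ω in {ω | N m ω = n}, f (R₁ m ω) * g (R₂ m ω) ∂P =
      P.real {ω | N m ω = n} * ∫ ω, f (R₁ m ω) * g (R₂ m ω) ∂(cond P {ω | N m ω = n}) := by
    rw [ProbabilityTheory.cond, integral_smul_measure, smul_eq_mul, ← mul_assoc, ENNReal.toReal_inv, measureReal_def,
      mul_inv_cancel₀, one_mul]
    exact ENNReal.toReal_ne_zero.2 ⟨h0, measure_ne_top _ _⟩
  have hf : Measurable f := measurable_from_top
  have hg : Measurable g := measurable_from_top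
  rw [hc, hP, smul_eq_mul]
  congr 1
  rw [← (h.cond_law_R₁ m n).integral_comp hf.aestronglyMeasurable,
    ← (h.cond_law_R₂ m n).integral_comp hg.aestronglyMeasurable]
  exact ((h.cond_indep m n).comp hf hg).integral_fun_mul_eq_mul_integral
    (hf.comp (h.measurable_R₁ m)).aestronglyMeasurable
    (hg.comp (h.measurable_R₂ m)).aestronglyMeasurable

/-- Identical distribution of the items is not part of the model; it follows because conditioning on
`N` expresses each point mass through `lam`, `p₁`, `p₂` alone. -/
lemma map_prodMk_eq (h : Model P lam p₁ p₂ N R₁ R₂) (m m' : ℕ) :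
    P.map (fun ω => (R₁ m ω, R₂ m ω)) = P.map (fun ω => (R₁ m' ω, R₂ m' ω)) := by
  have hm : ∀ m, Measurable (fun ω => (R₁ m ω, R₂ m ω)) := fun m =>
    (h.measurable_R₁ m).prodMk (h.measurable_R₂ m)
  have : ∀ m, IsProbabilityMeasure (P.map (fun ω => (R₁ m ω, R₂ m ω))) := fun m =>
    Measure.isProbabilityMeasure_map (hm m).aemeasurable
  refine Measure.ext_of_measureReal_singleton fun ab => ?_
  have key : ∀ m, (P.map (fun ω => (R₁ m ω, R₂ m ω))).real {ab} =
      ∫ n, (∫ k, ({ab.1} : Set ℕ).indicator 1 k ∂binomial n p₁) *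
        ∫ k, ({ab.2} : Set ℕ).indicator 1 k ∂binomial n p₂ ∂poissonMeasure lam := by
    intro m
    rw [map_measureReal_apply (hm m) (measurableSet_singleton ab),
      ← integral_indicator_one (hm m (measurableSet_singleton ab))]
    have e : ((fun ω => (R₁ m ω, R₂ m ω)) ⁻¹' {ab}).indicator (1 : Ω → ℝ) = fun ω =>
        ({ab.1} : Set ℕ).indicator (1 : ℕ → ℝ) (R₁ m ω) *
          ({ab.2} : Set ℕ).indicator (1 : ℕ → ℝ) (R₂ m ω) := by
      funext ω
      by_cases h1 : R₁ m ω = ab.1 <;> by_cases h2 : R₂ m ω = ab.2 <;>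
        simp [Set.indicator, Prod.ext_iff, h1, h2]
    have hi : Integrable (((fun ω => (R₁ m ω, R₂ m ω)) ⁻¹' {ab}).indicator (1 : Ω → ℝ)) P :=
      (integrable_const (1 : ℝ)).indicator (hm m (measurableSet_singleton ab))
    rw [e] at hi ⊢
    exact h.integral_mul m hi
  rw [key m, key m']

/-- The mixed moments `E (R₁ ^ i * R₂ ^ j)`. -/
def mixedMoment (l p₁ p₂ : ℝ) : Matrix (Fin 3) (Fin 3) ℝ :=
  !![1, l * p₂, l * p₂ + l ^ 2 * p₂ ^ 2;
    l * p₁, p₁ * p₂ * (l ^ 2 + l), p₁ * p₂ * (l ^ 2 + l) + p₁ * p₂ ^ 2 * (l ^ 3 + 2 * l ^ 2);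
    l * p₁ + l ^ 2 * p₁ ^ 2, p₁ * p₂ * (l ^ 2 + l) + p₁ ^ 2 * p₂ * (l ^ 3 + 2 * l ^ 2),
    p₁ * p₂ * (l ^ 2 + l) + (p₁ * p₂ ^ 2 + p₁ ^ 2 * p₂) * (l ^ 3 + 2 * l ^ 2) +
      p₁ ^ 2 * p₂ ^ 2 * (l ^ 4 + 4 * l ^ 3 + 2 * l ^ 2)]

lemma integral_binomialMoment_mul (lam : ℝ≥0) (p₁ p₂ : ℝ) (i j : Fin 3) :
    ∫ n : ℕ, binomialMoment p₁ n i * binomialMoment p₂ n j ∂poissonMeasure lam =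
      mixedMoment lam p₁ p₂ i j := by
  -- In each case the witnesses are the coefficients of the product in the falling factorial basis,
  -- whose Poisson expectations are the powers of `lam`.
  have key : ∀ c₀ c₁ c₂ c₃ c₄ : ℝ, (∀ x : ℝ, binomialMoment p₁ x i * binomialMoment p₂ x j =
      c₀ + c₁ * x + c₂ * (x * (x - 1)) + c₃ * (x * (x - 1) * (x - 2)) +
      c₄ * (x * (x - 1) * (x - 2) * (x - 3))) →
      c₀ + c₁ * lam + c₂ * lam ^ 2 + c₃ * lam ^ 3 + c₄ * lam ^ 4 = mixedMoment lam p₁ p₂ i j →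
      ∫ n : ℕ, binomialMoment p₁ n i * binomialMoment p₂ n j ∂poissonMeasure lam =
        mixedMoment lam p₁ p₂ i j := by
    intro c₀ c₁ c₂ c₃ c₄ h1 h2
    simp only [h1, integral_quartic_poissonMeasure, h2]
  fin_cases i <;> fin_cases j
  · apply key 1 0 0 0 0 <;> intros <;> simp [binomialMoment, mixedMoment]
  · apply key 0 p₂ 0 0 0 <;> intros <;> simp [binomialMoment, mixedMoment] <;> ring
  · apply key 0 p₂ (p₂ ^ 2) 0 0 <;> intros <;> simp [binomialMoment, mixedMoment] <;> ring
  · apply key 0 p₁ 0 0 0 <;> intros <;> simp [binomialMoment, mixedMoment] <;> ring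
  · apply key 0 (p₁ * p₂) (p₁ * p₂) 0 0 <;> intros <;> simp [binomialMoment, mixedMoment] <;> ring
  · apply key 0 (p₁ * p₂) (p₁ * p₂ + 2 * p₁ * p₂ ^ 2) (p₁ * p₂ ^ 2) 0 <;> intros <;>
      simp [binomialMoment, mixedMoment] <;> ring
  · apply key 0 p₁ (p₁ ^ 2) 0 0 <;> intros <;> simp [binomialMoment, mixedMoment] <;> ring
  · apply key 0 (p₁ * p₂) (p₁ * p₂ + 2 * p₁ ^ 2 * p₂) (p₁ ^ 2 * p₂) 0 <;> intros <;>
      simp [binomialMoment, mixedMoment] <;> ring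
  · apply key 0 (p₁ * p₂) (p₁ * p₂ + 2 * (p₁ * p₂ ^ 2 + p₁ ^ 2 * p₂) + 2 * p₁ ^ 2 * p₂ ^ 2)
      (p₁ * p₂ ^ 2 + p₁ ^ 2 * p₂ + 4 * p₁ ^ 2 * p₂ ^ 2) (p₁ ^ 2 * p₂ ^ 2) <;> intros <;>
      simp [binomialMoment, mixedMoment] <;> ring

lemma hasAllMoments_pow_mul_pow (h : Model P lam p₁ p₂ N R₁ R₂) (m i j : ℕ) :
    HasAllMoments (fun ω => (R₁ m ω : ℝ) ^ i * (R₂ m ω : ℝ) ^ j) P := by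
  have h1 := HasAllMoments.prod (Finset.range i) fun _ _ => h.hasAllMoments_R₁ m
  have h2 := HasAllMoments.prod (Finset.range j) fun _ _ => h.hasAllMoments_R₂ m
  simpa using h1.mul h2

lemma integral_biquadratic (h : Model P lam p₁ p₂ N R₁ R₂) (m : ℕ)
    (c : Matrix (Fin 3) (Fin 3) ℝ) :
    ∫ ω, ∑ i, ∑ j, c i j * ((R₁ m ω : ℝ) ^ (i : ℕ) * (R₂ m ω : ℝ) ^ (j : ℕ)) ∂P =
      ∑ i, ∑ j, c i j * mixedMoment lam p₁ p₂ i j := by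
  have hi := fun i j : Fin 3 => (h.hasAllMoments_pow_mul_pow m i j)
  rw [integral_finsetSum _ fun i _ =>
    (HasAllMoments.sum _ fun j _ => (hi i j).const_mul (c i j)).integrable]
  refine Finset.sum_congr rfl fun i _ => ?_
  rw [integral_finsetSum _ fun j _ => ((hi i j).const_mul (c i j)).integrable]
  refine Finset.sum_congr rfl fun j _ => ?_
  rw [integral_const_mul, h.integral_mul m (f := fun k => (k : ℝ) ^ (i : ℕ))
    (g := fun k => (k : ℝ) ^ (j : ℕ)) (hi i j).integrable]
  simp only [integral_pow_binomial, integral_binomialMoment_mul]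

end Model

/-! ### Algebra and integrality of the sample statistics -/

section Estimators

lemma measurable_quotOr {Ω : Type*} [MeasurableSpace Ω] (c : ℝ) {f g : Ω → ℝ} (hf : Measurable f)
    (hg : Measurable g) : Measurable fun ω => quotOr c (f ω) (g ω) :=
  Measurable.ite (measurableSet_eq_fun hg measurable_const) measurable_const (hf.div hg)

lemma sampleCov_comm (r s : ℕ → ℕ) (M : ℕ) : sampleCov r s M = sampleCov s r M := by
  simp only [sampleCov, mul_comm]

lemma pHat₂_eq_pHat₁ (c : ℝ) (r s : ℕ → ℕ) (M : ℕ) : pHat₂ c r s M = pHat₁ c s r M := by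
  rw [pHat₂, pHat₁, sampleCov_comm]

/-- The polynomials in one pair of counts whose averages determine the moment estimators. -/
def centered (l p₁ p₂ : ℝ) : Fin 3 → ℕ × ℕ → ℝ :=
  ![fun r => r.1 - l * p₁, fun r => r.2 - l * p₂,
    fun r => (r.1 - l * p₁) * (r.2 - l * p₂) - l * p₁ * p₂]

variable {r s : ℕ → ℕ} {M : ℕ}

lemma sampleMean_fst_eq (l p₁ p₂ : ℝ) (hM : 1 ≤ M) :
    sampleMean r M = l * p₁ + 1 / (M : ℝ) *
      ∑ m ∈ Finset.range M, centered l p₁ p₂ 0 (r m, s m) := by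
  have hM' : (M : ℝ) ≠ 0 := by positivity
  simp only [sampleMean, centered, Matrix.cons_val_zero, Finset.sum_sub_distrib,
    Finset.sum_const, Finset.card_range, nsmul_eq_mul]
  field_simp
  ring

lemma sampleMean_snd_eq (l p₁ p₂ : ℝ) (hM : 1 ≤ M) :
    sampleMean s M = l * p₂ + 1 / (M : ℝ) *
      ∑ m ∈ Finset.range M, centered l p₁ p₂ 1 (r m, s m) := by
  have hM' : (M : ℝ) ≠ 0 := by positivity
  simp only [sampleMean, centered, Matrix.cons_val_one, Matrix.cons_val_zero,
    Finset.sum_sub_distrib, Finset.sum_const, Finset.card_range, nsmul_eq_mul]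
  field_simp
  ring

lemma centered_cov_eq (l p₁ p₂ : ℝ) (hM : 1 ≤ M) :
    l * p₁ * p₂ + 1 / (M : ℝ) * ∑ m ∈ Finset.range M, centered l p₁ p₂ 2 (r m, s m) -
      (1 / (M : ℝ) * ∑ m ∈ Finset.range M, centered l p₁ p₂ 0 (r m, s m)) *
      (1 / (M : ℝ) * ∑ m ∈ Finset.range M, centered l p₁ p₂ 1 (r m, s m)) =
    1 / (M : ℝ) * ∑ m ∈ Finset.range M, (r m : ℝ) * s m - sampleMean r M * sampleMean s M := by
  have hM' : (M : ℝ) ≠ 0 := by positivity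
  simp only [sampleMean, centered, Matrix.cons_val, Finset.sum_sub_distrib,
    Finset.sum_const, Finset.card_range, nsmul_eq_mul, sub_mul, mul_sub, ← Finset.mul_sum,
    ← Finset.sum_mul]
  field_simp
  ring

lemma sampleCov_eq (hM : 2 ≤ M) :
    sampleCov r s M = M / ((M : ℝ) - 1) *
      (1 / (M : ℝ) * ∑ m ∈ Finset.range M, (r m : ℝ) * s m - sampleMean r M * sampleMean s M) := by
  have hM' : (M : ℝ) ≠ 0 := by positivity
  have hM1 : (M : ℝ) - 1 ≠ 0 := by
    have : (2 : ℝ) ≤ M := by exact_mod_cast hM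
    linarith
  simp only [sampleCov, sampleMean, Finset.sum_sub_distrib, Finset.sum_const, Finset.card_range,
    nsmul_eq_mul, sub_mul, mul_sub, ← Finset.mul_sum, ← Finset.sum_mul]
  field_simp
  ring

lemma one_le_of_sampleMean_ne_zero (hM : 1 ≤ M) (h : sampleMean r M ≠ 0) :
    1 ≤ (M : ℝ) ^ 2 * |sampleMean r M| := by
  have hM' : (1 : ℝ) ≤ M := by exact_mod_cast hM
  have e : sampleMean r M = (1 / (M : ℝ)) * ((∑ m ∈ Finset.range M, r m : ℕ) : ℝ) := by
    simp [sampleMean]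
  have h1 : 1 ≤ ∑ m ∈ Finset.range M, r m := by
    by_contra hc
    have : ∑ m ∈ Finset.range M, r m = 0 := by omega
    rw [this] at e
    simp [e] at h
  have h1' : (1 : ℝ) ≤ ((∑ m ∈ Finset.range M, r m : ℕ) : ℝ) := by exact_mod_cast h1
  rw [e, abs_of_nonneg (by positivity), ← mul_assoc]
  have : (M : ℝ) ^ 2 * (1 / M) = M := by field_simp
  rw [this]
  nlinarith

/-- Multiplied by `M ^ 2`, the empirical covariance is the integer `M ∑ rs - (∑ r)(∑ s)`. -/
lemma one_le_of_cov_ne_zero (hM : 1 ≤ M)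
    (h : 1 / (M : ℝ) * ∑ m ∈ Finset.range M, (r m : ℝ) * s m -
      sampleMean r M * sampleMean s M ≠ 0) :
    1 ≤ (M : ℝ) ^ 2 * |1 / (M : ℝ) * ∑ m ∈ Finset.range M, (r m : ℝ) * s m -
      sampleMean r M * sampleMean s M| := by
  have hM' : (M : ℝ) ≠ 0 := by positivity
  have e : (M : ℝ) ^ 2 * (1 / (M : ℝ) * ∑ m ∈ Finset.range M, (r m : ℝ) * s m -
      sampleMean r M * sampleMean s M) =
      ((M * ∑ m ∈ Finset.range M, (r m : ℤ) * s m -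
        (∑ m ∈ Finset.range M, (r m : ℤ)) * ∑ m ∈ Finset.range M, (s m : ℤ) : ℤ) : ℝ) := by
    push_cast
    simp only [sampleMean]
    field_simp
  rw [← abs_of_nonneg (by positivity : (0 : ℝ) ≤ (M : ℝ) ^ 2), ← abs_mul, e, ← Int.cast_abs]
  have h0 := mul_ne_zero (pow_ne_zero 2 hM') h
  rw [e] at h0
  exact_mod_cast Int.one_le_abs (by exact_mod_cast h0)

end Estimators

/-! ### Centered counts and their covariance matrix -/

namespace Model

variable {Ω : Type*} [MeasurableSpace Ω] {P : Measure Ω}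
  {lam : ℝ≥0} {p₁ p₂ : I} {N R₁ R₂ : ℕ → Ω → ℕ}

lemma symm (h : Model P lam p₁ p₂ N R₁ R₂) : Model P lam p₂ p₁ N R₂ R₁ where
  measurable_N := h.measurable_N
  measurable_R₁ := h.measurable_R₂
  measurable_R₂ := h.measurable_R₁
  indep_items := h.indep_items.comp (fun _ t => (t.1, t.2.2, t.2.1)) fun _ => .of_discrete
  law_N := h.law_N
  cond_law_R₁ := h.cond_law_R₂
  cond_law_R₂ := h.cond_law_R₁
  cond_indep := fun m n => (h.cond_indep m n).symm

lemma measurable_sampleMean {R : ℕ → Ω → ℕ} (hR : ∀ m, Measurable (R m)) (M : ℕ) :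
    Measurable fun ω => sampleMean (fun m => R m ω) M := by
  have : ∀ m, Measurable fun ω => (R m ω : ℝ) := fun m =>
    (measurable_from_top (f := fun k : ℕ => (k : ℝ))).comp (hR m)
  unfold sampleMean
  fun_prop

lemma measurable_sampleCov (h : Model P lam p₁ p₂ N R₁ R₂) (M : ℕ) :
    Measurable fun ω => sampleCov (fun m => R₁ m ω) (fun m => R₂ m ω) M := by
  have hc : ∀ {R : ℕ → Ω → ℕ}, (∀ m, Measurable (R m)) → ∀ m, Measurable fun ω => (R m ω : ℝ) :=
    fun hR m => (measurable_from_top (f := fun k : ℕ => (k : ℝ))).comp (hR m)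
  have h1 := hc h.measurable_R₁
  have h2 := hc h.measurable_R₂
  have h3 := measurable_sampleMean h.measurable_R₁ M
  have h4 := measurable_sampleMean h.measurable_R₂ M
  unfold sampleCov
  fun_prop

variable [IsProbabilityMeasure P]

/-- The centered variables whose averages determine the moment estimators. -/
def centeredCounts (l p₁ p₂ : ℝ) (R₁ R₂ : ℕ → Ω → ℕ) (i : Fin 3) (m : ℕ) (ω : Ω) : ℝ :=
  centered l p₁ p₂ i (R₁ m ω, R₂ m ω)

lemma integral_centered_eq (h : Model P lam p₁ p₂ N R₁ R₂) (m : ℕ) {F : ℝ → ℝ → ℝ}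
    (c : Matrix (Fin 3) (Fin 3) ℝ) {v : ℝ}
    (hc : ∀ a b : ℝ, F a b = ∑ i : Fin 3, ∑ j : Fin 3, c i j * (a ^ (i : ℕ) * b ^ (j : ℕ)))
    (hv : ∑ i, ∑ j, c i j * mixedMoment lam p₁ p₂ i j = v) :
    ∫ ω, F (R₁ m ω) (R₂ m ω) ∂P = v := by
  simp only [hc, h.integral_biquadratic m c, hv]

lemma centeredSequence (h : Model P lam p₁ p₂ N R₁ R₂) :
    CenteredSequence P (centeredCounts lam p₁ p₂ R₁ R₂) where
  measurable i m := (Measurable.of_discrete (f := centered lam p₁ p₂ i)).comp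
    ((h.measurable_R₁ m).prodMk (h.measurable_R₂ m))
  indep := h.indep_items.comp (fun _ t i => centered lam p₁ p₂ i t.2) fun _ => .of_discrete
  moments i m := by
    have h1 := (h.hasAllMoments_R₁ m).sub (HasAllMoments.const ((lam : ℝ) * p₁))
    have h2 := (h.hasAllMoments_R₂ m).sub (HasAllMoments.const ((lam : ℝ) * p₂))
    fin_cases i
    · exact h1
    · exact h2
    · exact (h1.mul h2).sub (HasAllMoments.const ((lam : ℝ) * p₁ * p₂))
  mean i m := by
    fin_cases i
    · refine h.integral_centered_eq m (F := fun a _ => a - lam * p₁)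
        !![-(lam * p₁), 0, 0; 1, 0, 0; 0, 0, 0] (fun a b => ?_) ?_ <;>
        simp [Fin.sum_univ_three, mixedMoment] <;> ring
    · refine h.integral_centered_eq m (F := fun _ b => b - lam * p₂)
        !![-(lam * p₂), 1, 0; 0, 0, 0; 0, 0, 0] (fun a b => ?_) ?_ <;>
        simp [Fin.sum_univ_three, mixedMoment] <;> ring
    · refine h.integral_centered_eq m
        (F := fun a b => (a - lam * p₁) * (b - lam * p₂) - lam * p₁ * p₂)
        !![lam * p₁ * (lam * p₂) - lam * p₁ * p₂, -(lam * p₁), 0; -(lam * p₂), 1, 0; 0, 0, 0]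
        (fun a b => ?_) ?_ <;>
        simp [Fin.sum_univ_three, mixedMoment] <;> ring
  stationary ι s f m := by
    have hm : ∀ m, AEMeasurable (fun ω => (R₁ m ω, R₂ m ω)) P := fun m =>
      ((h.measurable_R₁ m).prodMk (h.measurable_R₂ m)).aemeasurable
    have hf : ∀ μ : Measure (ℕ × ℕ), AEStronglyMeasurable
        (fun r : ℕ × ℕ => ∏ j ∈ s, centered lam p₁ p₂ (f j) r) μ := fun _ =>
      Measurable.of_discrete.aestronglyMeasurable
    have key := fun m => integral_map (hm m) (hf _)
    have hkey := key m
    rw [h.map_prodMk_eq m 0] at hkey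
    exact hkey.symm.trans (key 0)

/-- The covariance matrix of the centered variables. -/
def covariance (l p₁ p₂ : ℝ) : Matrix (Fin 3) (Fin 3) ℝ :=
  !![l * p₁, l * p₁ * p₂, l * p₁ * p₂;
    l * p₁ * p₂, l * p₂, l * p₁ * p₂;
    l * p₁ * p₂, l * p₁ * p₂, l * p₁ * p₂ + l ^ 2 * p₁ * p₂ + (l * p₁ * p₂) ^ 2]

lemma integral_centeredCounts_mul (h : Model P lam p₁ p₂ N R₁ R₂) (i j : Fin 3) :
    ∫ ω, centeredCounts lam p₁ p₂ R₁ R₂ i 0 ω * centeredCounts lam p₁ p₂ R₁ R₂ j 0 ω ∂P =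
      covariance lam p₁ p₂ i j := by
  wlog hij : i ≤ j generalizing i j
  · have := this j i (le_of_not_ge hij)
    simp only [mul_comm (centeredCounts _ _ _ _ _ i _ _), this]
    fin_cases i <;> fin_cases j <;> rfl
  -- Row `k` of `A` lists the coefficients of `(a - lam * p₁) ^ k` in powers of `a`; `B` does the
  -- same for the second count.
  let A : Matrix (Fin 3) (Fin 3) ℝ :=
    !![1, 0, 0; -(lam * p₁), 1, 0; (lam * p₁) ^ 2, -2 * (lam * p₁), 1]
  let B : Matrix (Fin 3) (Fin 3) ℝ :=
    !![1, 0, 0; -(lam * p₂), 1, 0; (lam * p₂) ^ 2, -2 * (lam * p₂), 1]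
  fin_cases i <;> fin_cases j <;> first | (exact absurd hij (by decide)) | skip
  · refine h.integral_centered_eq 0 (F := fun a b => (a - lam * p₁) * (a - lam * p₁))
      (.of fun i j => A 2 i * B 0 j) (fun a b => ?_) ?_ <;>
      simp [Fin.sum_univ_three, mixedMoment, A, B, covariance] <;> ring
  · refine h.integral_centered_eq 0 (F := fun a b => (a - lam * p₁) * (b - lam * p₂))
      (.of fun i j => A 1 i * B 1 j) (fun a b => ?_) ?_ <;>
      simp [Fin.sum_univ_three, mixedMoment, A, B, covariance] <;> ring
  · refine h.integral_centered_eq 0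
      (F := fun a b => (a - lam * p₁) * ((a - lam * p₁) * (b - lam * p₂) - lam * p₁ * p₂))
      (.of fun i j => A 2 i * B 1 j - lam * p₁ * p₂ * (A 1 i * B 0 j)) (fun a b => ?_) ?_ <;>
      simp [Fin.sum_univ_three, mixedMoment, A, B, covariance] <;> ring
  · refine h.integral_centered_eq 0 (F := fun a b => (b - lam * p₂) * (b - lam * p₂))
      (.of fun i j => A 0 i * B 2 j) (fun a b => ?_) ?_ <;>
      simp [Fin.sum_univ_three, mixedMoment, A, B, covariance] <;> ring
  · refine h.integral_centered_eq 0
      (F := fun a b => (b - lam * p₂) * ((a - lam * p₁) * (b - lam * p₂) - lam * p₁ * p₂))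
      (.of fun i j => A 1 i * B 2 j - lam * p₁ * p₂ * (A 0 i * B 1 j)) (fun a b => ?_) ?_ <;>
      simp [Fin.sum_univ_three, mixedMoment, A, B, covariance] <;> ring
  · refine h.integral_centered_eq 0
      (F := fun a b => ((a - lam * p₁) * (b - lam * p₂) - lam * p₁ * p₂) *
        ((a - lam * p₁) * (b - lam * p₂) - lam * p₁ * p₂))
      (.of fun i j => A 2 i * B 2 j - 2 * (lam * p₁ * p₂) * (A 1 i * B 1 j) +
        (lam * p₁ * p₂) ^ 2 * (A 0 i * B 0 j)) (fun a b => ?_) ?_ <;>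
      simp [Fin.sum_univ_three, mixedMoment, A, B, covariance] <;> ring

end Model

/-- Certifies Taylor remainders: each one is written below as an explicit sum of such multiples of
triple products. -/
lemma mul_mul_mul_mem_pow_three {R : Type*} [CommRing R] {J : Ideal R} {x y z : R} (hx : x ∈ J)
    (hy : y ∈ J) (hz : z ∈ J) (p : R) : p * (x * y * z) ∈ J ^ 3 := by
  rw [pow_succ, pow_two]
  exact Ideal.mul_mem_left _ _ (Ideal.mul_mem_mul (Ideal.mul_mem_mul hx hy) hz)

/-! ### Expansions of the three expectations -/

namespace Model

variable {Ω : Type*} [MeasurableSpace Ω] {P : Measure Ω}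
  {lam : ℝ≥0} {p₁ p₂ : I} {N R₁ R₂ : ℕ → Ω → ℕ}

section Evaluation

omit [MeasurableSpace Ω]

variable {M : ℕ} (ω : Ω) (l q₁ q₂ : ℝ)

lemma add_average_zero (hM : 1 ≤ M) :
    l * q₁ + average (centeredCounts l q₁ q₂ R₁ R₂) M ω 0 = sampleMean (fun m => R₁ m ω) M :=
  (sampleMean_fst_eq (s := fun m => R₂ m ω) l q₁ q₂ hM).symm

lemma add_average_one (hM : 1 ≤ M) :
    l * q₂ + average (centeredCounts l q₁ q₂ R₁ R₂) M ω 1 = sampleMean (fun m => R₂ m ω) M :=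
  (sampleMean_snd_eq (r := fun m => R₁ m ω) l q₁ q₂ hM).symm

/-- The covariance of the empirical distribution, normalized by `1 / M`. -/
noncomputable def empiricalCov (r s : ℕ → ℕ) (M : ℕ) : ℝ :=
  1 / (M : ℝ) * ∑ m ∈ Finset.range M, (r m : ℝ) * s m - sampleMean r M * sampleMean s M

lemma add_average_two (hM : 1 ≤ M) :
    l * q₁ * q₂ + average (centeredCounts l q₁ q₂ R₁ R₂) M ω 2 -
      average (centeredCounts l q₁ q₂ R₁ R₂) M ω 0 * average (centeredCounts l q₁ q₂ R₁ R₂) M ω 1 =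
      empiricalCov (fun m => R₁ m ω) (fun m => R₂ m ω) M :=
  centered_cov_eq l q₁ q₂ hM

end Evaluation

variable [IsProbabilityMeasure P]

open MvPolynomial in
theorem expectation_pHat₁ (h : Model P lam p₁ p₂ N R₁ R₂) (hlam : 0 < lam) (hp₂ : 0 < p₂)
    (c : ℝ) :
    (∀ M : ℕ, 2 ≤ M →
      Integrable (fun ω => pHat₁ c (fun m => R₁ m ω) (fun m => R₂ m ω) M) P) ∧
    (fun M : ℕ => (∫ ω, pHat₁ c (fun m => R₁ m ω) (fun m => R₂ m ω) M ∂P) - (p₁ : ℝ))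
      =O[atTop] (fun M : ℕ => 1 / (M : ℝ) ^ 2) := by
  set l := (lam : ℝ) with hl
  have hl0 : 0 < l := by exact_mod_cast hlam
  set b := (p₂ : ℝ) with hb
  set a := (p₁ : ℝ) with ha
  have hb0 : 0 < b := by exact_mod_cast hp₂
  set μ : ℝ := l * b with hμ
  have hμ0 : μ ≠ 0 := by positivity
  set e : ℝ := μ⁻¹ with he
  set t : ℝ := l * a * b with ht
  have heμ : e * μ = 1 := inv_mul_cancel₀ hμ0
  have het : e * t = a := by rw [he, ht, hμ]; field_simp
  let q : MvPolynomial (Fin 3) ℝ := C t + X 2 - X 0 * X 1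
  let D : MvPolynomial (Fin 3) ℝ := C μ + X 1
  have hX : ∀ i : Fin 3, (X i : MvPolynomial (Fin 3) ℝ) ∈ idealOfVars (Fin 3) ℝ := fun i =>
    Ideal.subset_span ⟨i, rfl⟩
  have hYe : 1 - C e * D = -(C e * X 1) := by
    have : (C e * C μ : MvPolynomial (Fin 3) ℝ) = 1 := by rw [← C_mul, heμ, C_1]
    simp only [D]
    linear_combination -this
  -- The factor cancels the `M / (M - 1)` in the unbiased covariance, so that `F` is exactly `q / D`
  -- with polynomials independent of `M`.
  let F : ℕ → Ω → ℝ := fun M ω =>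
    (((M : ℝ) - 1) / M) * pHat₁ c (fun m => R₁ m ω) (fun m => R₂ m ω) M
  have hFmeas : ∀ M, Measurable (F M) := fun M =>
    (measurable_quotOr c (h.measurable_sampleCov M)
      (measurable_sampleMean h.measurable_R₂ M)).const_mul _
  have hD : ∀ M, 2 ≤ M → ∀ ω, eval (average (centeredCounts l a b R₁ R₂) M ω) D =
      sampleMean (fun m => R₂ m ω) M := by
    intro M hM ω
    simp only [D, map_add, eval_C, eval_X, hμ]
    exact add_average_one ω l a b (by omega)
  have hq : ∀ M, 2 ≤ M → ∀ ω, eval (average (centeredCounts l a b R₁ R₂) M ω) q =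
      empiricalCov (fun m => R₁ m ω) (fun m => R₂ m ω) M := by
    intro M hM ω
    simp only [q, map_add, map_sub, map_mul, eval_C, eval_X, ht]
    exact add_average_two ω l a b (by omega)
  have hM2 : ∀ M : ℕ, 2 ≤ M → (2 : ℝ) ≤ M := fun M hM => by exact_mod_cast hM
  -- `c₀`, `l`, `Q` are the Taylor coefficients of `(t + x₂ - x₀x₁) / (μ + x₁)` up to order two,
  -- with `e * t = a`.
  obtain ⟨hint, C₀, hC₀⟩ := h.centeredSequence.expectation_quotient (q := q) (D := D) (e := e)
    (K := |c|) (c₀ := a) (l := ![0, -(e * a), e]) (Q := !![0, -e, 0; 0, e ^ 2 * a, -e ^ 2; 0, 0, 0])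
    (F := F) (inv_ne_zero hμ0) (abs_nonneg c)
    (by rw [hYe]; exact neg_mem (Ideal.mul_mem_left _ _ (hX 1)))
    (by
      rw [hYe]
      have hm := add_mem (add_mem
        (mul_mul_mul_mem_pow_three (hX 0) (hX 1) (hX 1)
          (C e ^ 2 * (1 - C e * X 1 + C e ^ 2 * X 1 ^ 2)))
        (mul_mul_mul_mem_pow_three (hX 2) (hX 1) (hX 1) (C e ^ 3 * (1 - C e * X 1))))
        (mul_mul_mul_mem_pow_three (hX 1) (hX 1) (hX 1) (-(C t * C e ^ 4)))
      convert hm using 1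
      simp only [q, quadraticPolynomial, Fin.sum_univ_three, ← het]
      simp
      ring)
    (fun M => (hFmeas M).aestronglyMeasurable)
    (by
      intro M hM ω h0
      rw [hD M hM] at h0
      have := hM2 M hM
      simp only [F, pHat₁, quotOr, if_pos h0, abs_mul]
      have h1 : |((M : ℝ) - 1) / M| ≤ 1 := by
        rw [abs_of_nonneg (div_nonneg (by linarith) (by linarith)), div_le_one (by linarith)]
        linarith
      nlinarith [abs_nonneg c])
    (by
      intro M hM ω h0
      rw [hD M hM] at h0 ⊢
      rw [hq M hM]
      have := hM2 M hM
      refine ⟨?_, one_le_of_sampleMean_ne_zero (by omega) h0⟩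
      have h1 : (M : ℝ) ≠ 0 := by linarith
      have h2 : (M : ℝ) - 1 ≠ 0 := by linarith
      simp only [F, pHat₁, quotOr, if_neg h0, sampleCov_eq hM]
      rw [← empiricalCov]
      field_simp)
  have hF : ∀ M : ℕ, 2 ≤ M → ∀ ω, pHat₁ c (fun m => R₁ m ω) (fun m => R₂ m ω) M =
      ((M : ℝ) / (M - 1)) * F M ω := by
    intro M hM ω
    have := hM2 M hM
    have h1 : (M : ℝ) ≠ 0 := by linarith
    have h2 : (M : ℝ) - 1 ≠ 0 := by linarith
    simp only [F]
    field_simp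
  refine ⟨fun M hM => ?_, ?_⟩
  · simp only [hF M hM]
    exact (hint M hM).const_mul _
  · refine IsBigO.of_bound (2 * C₀) (eventually_atTop.2 ⟨2, fun M hM => ?_⟩)
    have hMr := hM2 M hM
    have h1 : (M : ℝ) ≠ 0 := by linarith
    have h2 : (M : ℝ) - 1 ≠ 0 := by linarith
    have hc := hC₀ M hM
    simp only [h.integral_centeredCounts_mul, Fin.sum_univ_three] at hc
    -- The `1 / M` bias of `F` is precisely what undoing its normalization removes, hence no
    -- first-order term for the estimator.
    have hval : a + -a / (M : ℝ) = a * ((M - 1) / M) := by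
      field_simp
      ring
    simp only [covariance, Matrix.of_apply, Matrix.cons_val] at hc
    have hs : 0 * (l * a) + -e * (l * a * b) + 0 * (l * a * b) +
        (0 * (l * a * b) + e ^ 2 * a * (l * b) + -e ^ 2 * (l * a * b)) +
        (0 * (l * a * b) + 0 * (l * a * b) +
          0 * (l * a * b + l ^ 2 * a * b + (l * a * b) ^ 2)) = -a := by
      linear_combination (-1 : ℝ) * het
    rw [hs, hval] at hc
    have hFi : ∫ ω, pHat₁ c (fun m => R₁ m ω) (fun m => R₂ m ω) M ∂P - a =
        ((M : ℝ) / (M - 1)) * (∫ ω, F M ω ∂P - a * ((M - 1) / M)) := by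
      simp only [hF M hM, integral_const_mul]
      field_simp
    have hr : |(M : ℝ) / (M - 1)| ≤ 2 := by
      rw [abs_of_nonneg (div_nonneg (by linarith) (by linarith)), div_le_iff₀ (by linarith)]
      linarith
    rw [hFi, Real.norm_eq_abs, Real.norm_eq_abs, abs_mul, abs_of_nonneg
      (by positivity : (0 : ℝ) ≤ 1 / (M : ℝ) ^ 2)]
    calc _ ≤ 2 * (C₀ / (M : ℝ) ^ 2) := by gcongr
      _ = _ := by ring

open MvPolynomial in
theorem expectation_lamHat (h : Model P lam p₁ p₂ N R₁ R₂) (hlam : 0 < lam) (hp₁ : 0 < p₁)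
    (hp₂ : 0 < p₂) (c : ℝ) :
    (∀ M : ℕ, 2 ≤ M →
      Integrable (fun ω => lamHat c (fun m => R₁ m ω) (fun m => R₂ m ω) M) P) ∧
    (fun M : ℕ => (∫ ω, lamHat c (fun m => R₁ m ω) (fun m => R₂ m ω) M ∂P) -
        ((lam : ℝ) +
          (((lam : ℝ) + 1) * (1 + 1 / ((p₁ : ℝ) * (p₂ : ℝ))) - 1 / (p₁ : ℝ) - 1 / (p₂ : ℝ)) *
            (1 / (M : ℝ))))
      =O[atTop] (fun M : ℕ => 1 / (M : ℝ) ^ 2) := by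
  set l := (lam : ℝ) with hl
  have hl0 : 0 < l := by exact_mod_cast hlam
  set b := (p₂ : ℝ) with hb
  set a := (p₁ : ℝ) with ha
  have ha0 : 0 < a := by exact_mod_cast hp₁
  have hb0 : 0 < b := by exact_mod_cast hp₂
  set t : ℝ := l * a * b with ht
  have ht0 : t ≠ 0 := by positivity
  set e : ℝ := t⁻¹ with he
  have het : e * t = 1 := inv_mul_cancel₀ ht0
  have hem : e * (l * a) * (l * b) = l := by rw [he, ht]; field_simp
  let q : MvPolynomial (Fin 3) ℝ := (C (l * a) + X 0) * (C (l * b) + X 1)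
  let D : MvPolynomial (Fin 3) ℝ := C t + X 2 - X 0 * X 1
  have hX : ∀ i : Fin 3, (X i : MvPolynomial (Fin 3) ℝ) ∈ idealOfVars (Fin 3) ℝ := fun i =>
    Ideal.subset_span ⟨i, rfl⟩
  have hYe : 1 - C e * D = C e * (X 0 * X 1 - X 2) := by
    have : (C e * C t : MvPolynomial (Fin 3) ℝ) = 1 := by rw [← C_mul, het, C_1]
    simp only [D]
    linear_combination -this
  have hw : (X 0 * X 1 - X 2 : MvPolynomial (Fin 3) ℝ) ∈ idealOfVars (Fin 3) ℝ :=
    sub_mem (Ideal.mul_mem_left _ _ (hX 1)) (hX 2)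
  -- Needed since `(x₀x₁ - x₂)² - x₂² = x₀x₁ * (x₀x₁ - 2x₂)`: only `x₂²` belongs to the quadratic
  -- part.
  have hw2 : (X 0 * X 1 - 2 * X 2 : MvPolynomial (Fin 3) ℝ) ∈ idealOfVars (Fin 3) ℝ :=
    sub_mem (Ideal.mul_mem_left _ _ (hX 1)) (Ideal.mul_mem_left _ _ (hX 2))
  have hv : (C (l * a) * X 1 + C (l * b) * X 0 : MvPolynomial (Fin 3) ℝ) ∈
      idealOfVars (Fin 3) ℝ :=
    add_mem (Ideal.mul_mem_left _ _ (hX 1)) (Ideal.mul_mem_left _ _ (hX 0))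
  let F : ℕ → Ω → ℝ := fun M ω =>
    ((M : ℝ) / (M - 1)) * lamHat c (fun m => R₁ m ω) (fun m => R₂ m ω) M
  have hFmeas : ∀ M, Measurable (F M) := fun M =>
    (measurable_quotOr c ((measurable_sampleMean h.measurable_R₁ M).mul
      (measurable_sampleMean h.measurable_R₂ M)) (h.measurable_sampleCov M)).const_mul _
  have hD : ∀ M, 2 ≤ M → ∀ ω, eval (average (centeredCounts l a b R₁ R₂) M ω) D =
      empiricalCov (fun m => R₁ m ω) (fun m => R₂ m ω) M := by
    intro M hM ω
    simp only [D, map_add, map_sub, map_mul, eval_C, eval_X, ht]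
    exact add_average_two ω l a b (by omega)
  have hq : ∀ M, 2 ≤ M → ∀ ω, eval (average (centeredCounts l a b R₁ R₂) M ω) q =
      sampleMean (fun m => R₁ m ω) M * sampleMean (fun m => R₂ m ω) M := by
    intro M hM ω
    simp only [q, map_add (eval _), map_mul (eval _), eval_C, eval_X]
    rw [add_average_zero ω l a b (by omega), add_average_one ω l a b (by omega)]
  have hM2 : ∀ M : ℕ, 2 ≤ M → (2 : ℝ) ≤ M := fun M hM => by exact_mod_cast hM
  have hcov : ∀ M : ℕ, 2 ≤ M → ∀ ω, sampleCov (fun m => R₁ m ω) (fun m => R₂ m ω) M =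
      (M : ℝ) / (M - 1) * empiricalCov (fun m => R₁ m ω) (fun m => R₂ m ω) M := fun M hM ω =>
    sampleCov_eq hM
  -- Taylor coefficients of `(la + x₀)(lb + x₁) / (t + x₂ - x₀x₁)` up to order two. `K` is `2 * |c|`
  -- because `M / (M - 1) ≤ 2`.
  obtain ⟨hint, C₀, hC₀⟩ := h.centeredSequence.expectation_quotient (q := q) (D := D) (e := e)
    (K := 2 * |c|) (c₀ := e * (l * a) * (l * b))
    (l := ![e * (l * b), e * (l * a), -(e ^ 2 * (l * a) * (l * b))])
    (Q := !![0, e + e ^ 2 * (l * a) * (l * b), -(e ^ 2 * (l * b)); 0, 0, -(e ^ 2 * (l * a));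
      0, 0, e ^ 3 * (l * a) * (l * b)])
    (F := F) (inv_ne_zero ht0) (by positivity)
    (by rw [hYe]; exact Ideal.mul_mem_left _ _ hw)
    (by
      rw [hYe]
      have hm := add_mem (add_mem (add_mem (add_mem
        (mul_mul_mul_mem_pow_three (hX 0) (hX 1) hw2 (C e ^ 3 * C (l * a) * C (l * b)))
        (mul_mul_mul_mem_pow_three hw hw hw (C e ^ 4 * C (l * a) * C (l * b))))
        (mul_mul_mul_mem_pow_three (hX 0) (hX 1) hv (C e ^ 2)))
        (mul_mul_mul_mem_pow_three hw hw hv (C e ^ 3 * (1 + C e * (X 0 * X 1 - X 2)))))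
        (mul_mul_mul_mem_pow_three (hX 0) (hX 1) hw
          (C e ^ 2 * (1 + C e * (X 0 * X 1 - X 2) + C e ^ 2 * (X 0 * X 1 - X 2) ^ 2)))
      convert hm using 1
      simp only [q, quadraticPolynomial, Fin.sum_univ_three]
      simp
      ring)
    (fun M => (hFmeas M).aestronglyMeasurable)
    (by
      intro M hM ω h0
      rw [hD M hM] at h0
      have := hM2 M hM
      have h1 : |(M : ℝ) / (M - 1)| ≤ 2 := by
        rw [abs_of_nonneg (div_nonneg (by linarith) (by linarith)), div_le_iff₀ (by linarith)]
        linarith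
      simp only [F, lamHat, quotOr, hcov M hM, h0, mul_zero, if_true, abs_mul]
      gcongr)
    (by
      intro M hM ω h0
      rw [hD M hM] at h0 ⊢
      rw [hq M hM]
      have := hM2 M hM
      refine ⟨?_, one_le_of_cov_ne_zero (by omega) h0⟩
      have h1 : (M : ℝ) ≠ 0 := by linarith
      have h2 : (M : ℝ) - 1 ≠ 0 := by linarith
      have h3 : (M : ℝ) / (M - 1) * empiricalCov (fun m => R₁ m ω) (fun m => R₂ m ω) M ≠ 0 :=
        mul_ne_zero (div_ne_zero h1 h2) h0
      simp only [F, lamHat, quotOr, hcov M hM, if_neg h3]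
      field_simp)
  have hF : ∀ M : ℕ, 2 ≤ M → ∀ ω, lamHat c (fun m => R₁ m ω) (fun m => R₂ m ω) M =
      (((M : ℝ) - 1) / M) * F M ω := by
    intro M hM ω
    have := hM2 M hM
    have h1 : (M : ℝ) ≠ 0 := by linarith
    have h2 : (M : ℝ) - 1 ≠ 0 := by linarith
    simp only [F]
    field_simp
  refine ⟨fun M hM => ?_, ?_⟩
  · simp only [hF M hM]
    exact (hint M hM).const_mul _
  -- `A` is the `1 / M` coefficient for `F`. Multiplying `l + A / M` by `1 - 1 / M` turns it into `A
  -- - l` and leaves `-A / M ^ 2`, whence `|A|` in the constant.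
  · set A : ℝ := (l + 1) * (1 + 1 / (a * b)) - 1 / a - 1 / b + l with hA
    refine IsBigO.of_bound (C₀ + |A|) (eventually_atTop.2 ⟨2, fun M hM => ?_⟩)
    have hMr := hM2 M hM
    have h1 : (M : ℝ) ≠ 0 := by linarith
    have hc := hC₀ M hM
    simp only [h.integral_centeredCounts_mul, Fin.sum_univ_three] at hc
    simp only [covariance, Matrix.of_apply, Matrix.cons_val, zero_mul, zero_add, hem] at hc
    have hs : (e + e ^ 2 * (l * a) * (l * b)) * (l * a * b) + -(e ^ 2 * (l * b)) * (l * a * b) +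
        -(e ^ 2 * (l * a)) * (l * a * b) + e ^ 3 * (l * a) * (l * b) *
          (l * a * b + l ^ 2 * a * b + (l * a * b) ^ 2) = A := by
      rw [hA, he, ht]
      field_simp
      ring
    rw [hs] at hc
    have hFi : ∫ ω, lamHat c (fun m => R₁ m ω) (fun m => R₂ m ω) M ∂P -
        (l + ((l + 1) * (1 + 1 / (a * b)) - 1 / a - 1 / b) * (1 / (M : ℝ))) =
        (((M : ℝ) - 1) / M) * (∫ ω, F M ω ∂P - (l + A / M)) + -(A / (M : ℝ) ^ 2) := by
      have hA' : (l + 1) * (1 + 1 / (a * b)) - 1 / a - 1 / b = A - l := by rw [hA]; ring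
      simp only [hF M hM, integral_const_mul, hA']
      field_simp
      ring
    have hr : |((M : ℝ) - 1) / M| ≤ 1 := by
      rw [abs_of_nonneg (div_nonneg (by linarith) (by linarith)), div_le_one (by linarith)]
      linarith
    rw [hFi, Real.norm_eq_abs, Real.norm_eq_abs, abs_of_nonneg
      (by positivity : (0 : ℝ) ≤ 1 / (M : ℝ) ^ 2)]
    refine (abs_add_le _ _).trans ?_
    rw [abs_mul, abs_neg, abs_div A, abs_of_nonneg (by positivity : (0 : ℝ) ≤ (M : ℝ) ^ 2)]
    calc _ ≤ 1 * (C₀ / (M : ℝ) ^ 2) + |A| / (M : ℝ) ^ 2 := by gcongr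
      _ = _ := by ring

end Model

end DefectInspection

theorem theorem1 {Ω : Type*} [MeasurableSpace Ω] (P : Measure Ω) [IsProbabilityMeasure P]
    (lam : ℝ≥0) (p₁ p₂ : I) (hlam : 0 < lam) (hp₁ : 0 < p₁) (hp₂ : 0 < p₂)
    (N R₁ R₂ : ℕ → Ω → ℕ) (hmodel : DefectInspection.Model P lam p₁ p₂ N R₁ R₂) (c : ℝ) :
    (∀ M : ℕ, 2 ≤ M →
      Integrable (fun ω => DefectInspection.pHat₁ c (fun m => R₁ m ω) (fun m => R₂ m ω) M) P ∧
      Integrable (fun ω => DefectInspection.pHat₂ c (fun m => R₁ m ω) (fun m => R₂ m ω) M) P ∧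
      Integrable (fun ω => DefectInspection.lamHat c (fun m => R₁ m ω) (fun m => R₂ m ω) M) P) ∧
    (fun M : ℕ =>
      (∫ ω, DefectInspection.pHat₁ c (fun m => R₁ m ω) (fun m => R₂ m ω) M ∂P) - (p₁ : ℝ))
        =O[atTop] (fun M : ℕ => 1 / (M : ℝ) ^ 2) ∧
    (fun M : ℕ =>
      (∫ ω, DefectInspection.pHat₂ c (fun m => R₁ m ω) (fun m => R₂ m ω) M ∂P) - (p₂ : ℝ))
        =O[atTop] (fun M : ℕ => 1 / (M : ℝ) ^ 2) ∧
    (fun M : ℕ =>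
      (∫ ω, DefectInspection.lamHat c (fun m => R₁ m ω) (fun m => R₂ m ω) M ∂P) -
        ((lam : ℝ) +
          (((lam : ℝ) + 1) * (1 + 1 / ((p₁ : ℝ) * (p₂ : ℝ))) - 1 / (p₁ : ℝ) - 1 / (p₂ : ℝ)) *
            (1 / (M : ℝ))))
        =O[atTop] (fun M : ℕ => 1 / (M : ℝ) ^ 2) := by
  obtain ⟨i₁, e₁⟩ := hmodel.expectation_pHat₁ hlam hp₂ c
  obtain ⟨i₂, e₂⟩ := hmodel.symm.expectation_pHat₁ hlam hp₁ c
  obtain ⟨i₃, e₃⟩ := hmodel.expectation_lamHat hlam hp₁ hp₂ c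
  simp only [DefectInspection.pHat₂_eq_pHat₁]
  exact ⟨fun M hM => ⟨i₁ M hM, i₂ M hM, i₃ M hM⟩, e₁, e₂, e₃⟩
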